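/- Let $M$ be a closed (compact, without boundary) smooth $n$-dimensional manifold and let $v$ be a smooth ($C^\infty$) vector field on $M$. A singular point of $v$ is a zero of $v$. Suppose that (i) every singular point of $v$ is isolated; for every trajectory $\gamma:\mathbb R\to M$ of $\dot x=v(x)$, the $\alpha$-limit set and the $\omega$-limit set of $\gamma$ consist of singular points; and every singular point $x_i$ has an open neighbourhood $U_i$ that carries a smooth function $f_i:U_i\to\mathbb R$ and a smooth Riemannian metric $\rho_i$ such that $v$ is the gradient of $f_i$ with respect to $\rho_i$ on $U_i$; (ii) the oriented graph $G(v)$ has no contours. Here the vertices of $G(v)$ are the singular points of $v$, and there is an arc from $x$ to $y$ (where $x=y$ is allowed) if there is a nonconstant trajectory $\gamma$ with $\gamma(t)\to x$ as $t\to-\infty$ and $\gamma(t)\to y$ as $t\to+\infty$; a contour is a sequence of vertices $\alpha_0,\alpha_1,\dots,\alpha_k$ with $k\ge 1$ and $\alpha_0=\alpha_k$ such that there is an arc from $\alpha_{i-1}$ to $\alpha_i$ for every $i=1,\dots,k$. Then there are a smooth Riemannian metric $\rho$ on $M$ and a smooth function $f:M\to\mathbb R$ such that $\operatorname{grad}_\rho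 f=v$ on all of $M$. -/

import Mathlib

open Set Filter Topology Bundle
open scoped Manifold ContDiff

noncomputable section

namespace VectorFieldGraph

section Graph

variable {n : ℕ} {M : Type*} [TopologicalSpace M] [ChartedSpace (EuclideanSpace ℝ (Fin n)) M]

/-- The singular points (zeros) of a vector field. -/
def singularPoints (v : (x : M) → TangentSpace (𝓡 n) x) : Set M := {x | v x = 0}

/-- Every singular point has a neighbourhood that contains no other singular point. -/
def HasIsolatedSingularPoints (v : (x : M) → TangentSpace (𝓡 n) x) : Prop :=
  ∀ x ∈ singularPoints v, ∀ᶠ y in 𝓝[≠] x, y ∉ singularPoints v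

/-- The `ω`-limit set of a curve: all limits of `γ (t_k)` with `t_k → +∞`. -/
def omegaLimitSet (γ : ℝ → M) : Set M := {x | MapClusterPt x atTop γ}

/-- The `α`-limit set of a curve: all limits of `γ (t_k)` with `t_k → -∞`. -/
def alphaLimitSet (γ : ℝ → M) : Set M := {x | MapClusterPt x atBot γ}

/-- A smooth Riemannian metric on the set `U` (used for open `U`): a smooth field of symmetric
positive definite bilinear forms on the tangent spaces at the points of `U`. The values outside
`U` are irrelevant. -/
structure SmoothMetricOn [IsManifold (𝓡 n) ∞ M] (U : Set M) where
  inner (x : M) : TangentSpace (𝓡 n) x →L[ℝ] TangentSpace (𝓡 n) x →L[ℝ] ℝ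
  symm : ∀ x ∈ U, ∀ a b : TangentSpace (𝓡 n) x, inner x a b = inner x b a
  pos : ∀ x ∈ U, ∀ a : TangentSpace (𝓡 n) x, a ≠ 0 → 0 < inner x a a
  contMDiffOn : ContMDiffOn (𝓡 n)
    ((𝓡 n).prod 𝓘(ℝ, EuclideanSpace ℝ (Fin n) →L[ℝ] EuclideanSpace ℝ (Fin n) →L[ℝ] ℝ)) ∞
    (fun x ↦ TotalSpace.mk' (EuclideanSpace ℝ (Fin n) →L[ℝ] EuclideanSpace ℝ (Fin n) →L[ℝ] ℝ)
      (E := fun x : M ↦ TangentSpace (𝓡 n) x →L[ℝ] TangentSpace (𝓡 n) x →L[ℝ] ℝ) x (inner x)) U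

/-- `w` is the gradient of `f` at `x` with respect to the scalar product `ρ` on the tangent space
at `x`: `ρ (w, a) = df_x (a)` for all tangent vectors `a`. -/
def IsGradientAt (f : M → ℝ) (x : M)
    (ρ : TangentSpace (𝓡 n) x →L[ℝ] TangentSpace (𝓡 n) x →L[ℝ] ℝ)
    (w : TangentSpace (𝓡 n) x) : Prop :=
  ∀ a : TangentSpace (𝓡 n) x, ρ w a = mfderiv (𝓡 n) 𝓘(ℝ, ℝ) f x a

/-- Some open neighbourhood `U` of `x` carries a smooth function and a Riemannian metric for which
`v` is the gradient of the function on `U`. -/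
def IsLocallyGradientNear [IsManifold (𝓡 n) ∞ M] (v : (x : M) → TangentSpace (𝓡 n) x)
    (x : M) : Prop :=
  ∃ U : Set M, IsOpen U ∧ x ∈ U ∧ ∃ (f : M → ℝ) (ρ : SmoothMetricOn (n := n) U),
    ContMDiffOn (𝓡 n) 𝓘(ℝ, ℝ) ∞ f U ∧ ∀ y ∈ U, IsGradientAt f y (ρ.inner y) (v y)

/-- The oriented graph of `v`: the vertices are the singular points, and there is an arc from `x`
to `y` (possibly `x = y`) if a nonconstant integral trajectory starts at `x` and ends at `y`. -/
def graph (v : (x : M) → TangentSpace (𝓡 n) x) : Digraph (singularPoints v) where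
  Adj x y := ∃ γ : ℝ → M, IsMIntegralCurve γ v ∧ (∃ s t, γ s ≠ γ t) ∧
    Tendsto γ atBot (𝓝 (x : M)) ∧ Tendsto γ atTop (𝓝 (y : M))

end Graph

/-- A contour (oriented cycle) of an oriented graph: vertices `α 0, …, α k` with `k ≥ 1`, an arc
from each one to the next, and `α 0 = α k`. -/
def HasContour {V : Type*} (G : Digraph V) : Prop :=
  ∃ (k : ℕ) (α : Fin (k + 1) → V), 0 < k ∧
    (∀ i : Fin k, G.Adj (α i.castSucc) (α i.succ)) ∧ α 0 = α (Fin.last k)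

end VectorFieldGraph

end

/-! For a fixed function `f`, the scalar products on a tangent space for which `v` represents `df`
form a convex set, so local metrics of this kind glue by a partition of unity
(`exists_riemannianMetric_isGradientAt`). Where `df(v) > 0` such a metric can be written down
(`gradientForm`); near singular points the given one serves. It remains to find a global `f` that
has the given local differentials near the singular points and strictly increases along `v`
elsewhere (`IsRankedFlow.exists_potential`).

Take `f = k + c • G`, where `k` extends the local potentials, `G` never decreases along `v`, `dG =
0` near the singular points, `G` strictly increases on the compact set left to treat, and `c` is
large. To obtain `G`, note that compactness leaves finitely many singular points; without contours
they carry a rank that strictly increases along every nonconstant trajectory. For each `k`, the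
points whose orbits end below rank `k` and those whose orbits start at rank at least `k` form
disjoint closed sets, since limits of long orbit segments cannot lower the rank
(`rank_le_of_tendsto_ultrafilter`). If a smooth `F` with values in `[0, 1]` is `0` near the first
set and `1` near the second, then `F (φ T x) ≥ F x` for all `x` once `T` is large. The integral of
`F` along the flow during time `T` has derivative `F (φ T x) - F x` along `v`; finitely many such
integrals add up to `G`.

Smoothness of the flow comes from the inverse function theorem in a space of continuous curves,
followed by compactness and the group law. -/

noncomputable section

namespace VectorFieldGraph

/-! ### Convergence of curves with finitely many limit points -/

section TopologicalDynamics

variable {X : Type*} [TopologicalSpace X] [CompactSpace X] [T2Space X]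

/-- By compactness a tail of the curve lies in the union of two disjoint open sets, one around a
cluster point `s` and one around the rest of `S`. The tail is connected and meets the first, so it
never enters the second. -/
theorem exists_tendsto_atTop_of_clusterPt_subset_finite {S : Set X} (hS : S.Finite) {γ : ℝ → X}
    (hγ : Continuous γ) (h : ∀ x, MapClusterPt x atTop γ → x ∈ S) :
    ∃ s ∈ S, Tendsto γ atTop (𝓝 s) := by
  obtain ⟨s, hs⟩ : ∃ s, MapClusterPt s atTop γ := exists_clusterPt_of_compactSpace _
  have hsS := h s hs
  obtain ⟨U, V, hU, hV, hsU, hSV, hUV⟩ : SeparatedNhds ({s} : Set X) (S \ {s}) :=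
    SeparatedNhds.of_isCompact_isCompact isCompact_singleton (hS.subset sdiff_subset).isCompact
      disjoint_sdiff_right
  have hsub : S ⊆ U ∪ V := fun x hx ↦ by
    by_cases hxs : x = s
    · exact Or.inl (hsU hxs)
    · exact Or.inr (hSV ⟨hx, hxs⟩)
  have hev : ∀ᶠ t in atTop, γ t ∈ U ∪ V := by
    by_contra hne
    have hfr : ∃ᶠ t in atTop, γ t ∈ (U ∪ V)ᶜ := not_eventually.1 hne
    obtain ⟨y, hy, hyc⟩ := (hU.union hV).isClosed_compl.isCompact.exists_mapClusterPt_of_frequently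
      hfr
    exact hy (hsub (h y hyc))
  obtain ⟨T, hT⟩ := eventually_atTop.1 hev
  have hTU : γ '' Ici T ⊆ U := by
    refine IsPreconnected.subset_left_of_subset_union hU hV hUV ?_ ?_
      (isPreconnected_Ici.image γ hγ.continuousOn)
    · rintro _ ⟨t, ht, rfl⟩
      exact hT t ht
    · obtain ⟨t, ht, htU⟩ := (frequently_atTop.1 (hs.frequently (hU.mem_nhds (hsU rfl)))) T
      exact ⟨γ t, ⟨t, ht, rfl⟩, htU⟩
  refine ⟨s, hsS, tendsto_nhds_of_unique_mapClusterPt fun y hy ↦ ?_⟩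
  by_contra hys
  obtain ⟨t, ht, htV⟩ := (frequently_atTop.1
    (hy.frequently (hV.mem_nhds (hSV ⟨h y hy, hys⟩)))) T
  exact disjoint_left.1 hUV (hTU ⟨t, ht, rfl⟩) htV

theorem exists_tendsto_atBot_of_clusterPt_subset_finite {S : Set X} (hS : S.Finite) {γ : ℝ → X}
    (hγ : Continuous γ) (h : ∀ x, MapClusterPt x atBot γ → x ∈ S) :
    ∃ s ∈ S, Tendsto γ atBot (𝓝 s) := by
  obtain ⟨s, hs, ht⟩ := exists_tendsto_atTop_of_clusterPt_subset_finite hS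
    (hγ.comp continuous_neg) (fun x hx ↦ h x (by
      have := hx.of_comp tendsto_neg_atTop_atBot
      exact this))
  refine ⟨s, hs, ?_⟩
  have := ht.comp tendsto_neg_atBot_atTop
  simpa [Function.comp_def] using this

theorem neBot_curry {α β : Type*} (l : Filter α) (m : Filter β) [l.NeBot] [m.NeBot] :
    (l.curry m).NeBot := ⟨fun hbot ↦ by
  have hf : ∀ᶠ _ in l, ∀ᶠ _ in m, False :=
    eventually_curry_iff (p := fun _ ↦ False).1 (by rw [hbot]; exact eventually_bot)
  obtain ⟨_, ha⟩ := hf.exists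
  exact ha.exists.choose_spec⟩

end TopologicalDynamics

/-! ### Flows whose orbits increase a rank on finitely many fixed points -/

section RankedFlow

variable {X : Type*} [TopologicalSpace X]

/-- All orbits of the flow `φ` converge in both directions to points of the finite set `S` of fixed
points, and `r` increases strictly from the start to the end of every other orbit. -/
structure IsRankedFlow (φ : Flow ℝ X) (S : Set X) (r : X → ℕ) : Prop where
  finite : S.Finite
  fixed : ∀ s ∈ S, ∀ t, φ t s = s
  alpha : ∀ x, ∃ a ∈ S, Tendsto (φ · x) atBot (𝓝 a)
  omega : ∀ x, ∃ b ∈ S, Tendsto (φ · x) atTop (𝓝 b)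
  rank_lt : ∀ x ∉ S, ∀ a ∈ S, ∀ b ∈ S, Tendsto (φ · x) atBot (𝓝 a) →
    Tendsto (φ · x) atTop (𝓝 b) → r a < r b

namespace IsRankedFlow

variable {φ : Flow ℝ X} {S : Set X} {r : X → ℕ}

theorem tendsto_of_mem (h : IsRankedFlow φ S r) {s : X} (hs : s ∈ S) (l : Filter ℝ) :
    Tendsto (φ · s) l (𝓝 s) := by
  simpa only [h.fixed s hs] using tendsto_const_nhds

theorem tendsto_atBot_map {x a : X} (t : ℝ) (hxa : Tendsto (φ · x) atBot (𝓝 a)) :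
    Tendsto (φ · (φ t x)) atBot (𝓝 a) := by
  have := hxa.comp (tendsto_atBot_add_const_right atBot t tendsto_id)
  refine this.congr fun s ↦ ?_
  simp [φ.map_add]

variable [T2Space X]

theorem rank_le (h : IsRankedFlow φ S r) {x a b : X} (ha : a ∈ S) (hb : b ∈ S)
    (hxa : Tendsto (φ · x) atBot (𝓝 a)) (hxb : Tendsto (φ · x) atTop (𝓝 b)) : r a ≤ r b := by
  by_cases hx : x ∈ S
  · rw [tendsto_nhds_unique hxa (h.tendsto_of_mem hx _),
      tendsto_nhds_unique hxb (h.tendsto_of_mem hx _)]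
  · exact (h.rank_lt x hx a ha b hb hxa hxb).le

/-- The points whose orbits start at rank at least `k`. -/
def upperSet (φ : Flow ℝ X) (S : Set X) (r : X → ℕ) (k : ℕ) : Set X :=
  {x | ∃ a ∈ S, Tendsto (φ · x) atBot (𝓝 a) ∧ k ≤ r a}

/-- The points whose orbits end at rank less than `k`. -/
def lowerSet (φ : Flow ℝ X) (S : Set X) (r : X → ℕ) (k : ℕ) : Set X :=
  {x | ∃ b ∈ S, Tendsto (φ · x) atTop (𝓝 b) ∧ r b < k}

theorem disjoint_lowerSet_upperSet (h : IsRankedFlow φ S r) (k : ℕ) :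
    Disjoint (lowerSet φ S r k) (upperSet φ S r k) := by
  refine disjoint_left.2 ?_
  rintro x ⟨b, hb, hxb, hbk⟩ ⟨a, ha, hxa, hka⟩
  exact absurd (h.rank_le ha hb hxa hxb) (by omega)

variable [CompactSpace X]

/-- Long orbit segments from near `x` first linger near `b`. The limit of their exit points from a
neighbourhood of `b` lies on an orbit that starts at `b`, hence ends at higher rank; iterating
follows a chain of orbits up to `z`. The number `k` bounds the rank still available above `b`, which
makes the chain finite. -/
theorem rank_le_of_tendsto_ultrafilter (h : IsRankedFlow φ S r) {ι : Type*} (u : Ultrafilter ι)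
    {z a : X} (hz : Tendsto (φ · z) atBot (𝓝 a)) :
    ∀ (k : ℕ) {x b : X} {y : ι → X} {t : ι → ℝ}, b ∈ S → (∀ s ∈ S, r s ≤ r b + k) →
      Tendsto (φ · x) atTop (𝓝 b) → Tendsto y u (𝓝 x) → Tendsto t u atTop →
      Tendsto (fun i ↦ φ (t i) (y i)) u (𝓝 z) → r b ≤ r a := by
  intro k
  induction k using Nat.strong_induction_on with
  | _ k ih =>
  intro x b y t hb hk hxb hy ht hyz
  by_cases hzb : z = b
  · subst hzb
    rw [tendsto_nhds_unique hz (h.tendsto_of_mem hb _)]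
  -- `C` is a closed neighbourhood of `b` that avoids `z` and all other fixed points.
  obtain ⟨C, ⟨hCb, hC⟩, hCS⟩ := (closed_nhds_basis b).mem_iff.1
    (((h.finite.subset (sdiff_subset (t := {b}))).union (finite_singleton z)).isClosed.isOpen_compl.mem_nhds
      (x := b) (by
        rintro (hb' | hb')
        · exact hb'.2 rfl
        · exact hzb hb'.symm))
  have hzC : z ∉ C := fun hz' ↦ hCS hz' (Or.inr rfl)
  have hSC : ∀ s ∈ S, s ∈ C → s = b := fun s hs hsC ↦ by
    by_contra hsb
    exact hCS hsC (Or.inl ⟨hs, hsb⟩)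
  set W := interior C with hW
  have hbW : b ∈ W := mem_interior_iff_mem_nhds.2 hCb
  obtain ⟨T₀, hT₀⟩ := eventually_atTop.1 (hxb.eventually_mem (isOpen_interior.mem_nhds hbW))
  set E : ι → Set ℝ := fun i ↦ {σ | T₀ ≤ σ ∧ φ σ (y i) ∉ W} with hE
  -- The first exit time from `W` after `T₀`, a time beyond which the orbit of `x` stays in `W`.
  set τ : ι → ℝ := fun i ↦ sInf (E i) with hτ
  have hEcl : ∀ i, IsClosed (E i) := fun i ↦
    isClosed_Ici.inter (isOpen_interior.isClosed_compl.preimage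
      (φ.continuous continuous_id continuous_const))
  have hEbdd : ∀ i, BddBelow (E i) := fun i ↦ ⟨T₀, fun σ hσ ↦ hσ.1⟩
  have hEt : ∀ᶠ i in (u : Filter ι), t i ∈ E i := by
    filter_upwards [ht.eventually_ge_atTop T₀, hyz.eventually_mem (hC.isOpen_compl.mem_nhds hzC)]
      with i h1 h2
    exact ⟨h1, fun h3 ↦ h2 (interior_subset h3)⟩
  have hτE : ∀ᶠ i in (u : Filter ι), τ i ∈ E i := hEt.mono fun i hi ↦
    (hEcl i).csInf_mem ⟨_, hi⟩ (hEbdd i)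
  have hτt : ∀ᶠ i in (u : Filter ι), τ i ≤ t i := hEt.mono fun i hi ↦ csInf_le (hEbdd i) hi
  have hτW : ∀ i σ, T₀ ≤ σ → σ < τ i → φ σ (y i) ∈ W := fun i σ h1 h2 ↦ by
    by_contra h3
    exact absurd (csInf_le (hEbdd i) (show σ ∈ E i from ⟨h1, h3⟩)) (not_le.2 h2)
  -- On each compact time interval after `T₀`, orbits of points near `x` remain in `W` as well.
  have hτtop : Tendsto τ u atTop := by
    refine tendsto_atTop.2 fun T ↦ ?_
    have hK : ∀ᶠ y' in 𝓝 x, ∀ σ ∈ Icc T₀ T, φ σ y' ∈ W :=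
      isCompact_Icc.eventually_forall_of_forall_eventually fun σ hσ ↦
        (φ.continuous continuous_snd continuous_fst).continuousAt.eventually_mem
          (isOpen_interior.mem_nhds (hT₀ σ hσ.1))
    filter_upwards [hy.eventually hK, hτE] with i h1 h2
    by_contra h3
    exact h2.2 (h1 _ ⟨h2.1, (not_le.1 h3).le⟩)
  set z' := (u.map fun i ↦ φ (τ i) (y i)).lim
  have hz' : Tendsto (fun i ↦ φ (τ i) (y i)) u (𝓝 z') :=
    (u.map fun i ↦ φ (τ i) (y i)).le_nhds_lim
  have hz'W : z' ∉ W := isOpen_interior.isClosed_compl.mem_of_tendsto hz' (hτE.mono fun i hi ↦ hi.2)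
  have hback : ∀ σ < 0, φ σ z' ∈ C := fun σ hσ ↦ by
    have h1 : Tendsto (fun i ↦ φ σ (φ (τ i) (y i))) u (𝓝 (φ σ z')) :=
      ((φ.continuous continuous_const continuous_id).tendsto z').comp hz'
    refine hC.mem_of_tendsto h1 ?_
    filter_upwards [hτtop.eventually_ge_atTop (T₀ - σ)] with i hi
    rw [← φ.map_add]
    exact interior_subset (hτW i _ (by linarith) (by linarith))
  obtain ⟨a', ha', hza'⟩ := h.alpha z'
  obtain ⟨b', hb', hzb'⟩ := h.omega z'
  have hab : a' = b := hSC a' ha' (hC.mem_of_tendsto hza' ((eventually_lt_atBot 0).mono hback))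
  subst hab
  have hz'S : z' ∉ S := fun hzS ↦ by
    rw [tendsto_nhds_unique hza' (h.tendsto_of_mem hzS _)] at hbW
    exact hz'W hbW
  have hlt := h.rank_lt z' hz'S a' ha' b' hb' hza' hzb'
  -- Either the remaining times are unbounded and induction applies from `z'`, or they converge
  -- along the ultrafilter, and then `z` lies on the orbit of `z'` and starts at `b` itself.
  by_cases hbd : Tendsto (fun i ↦ t i - τ i) u atTop
  · refine hlt.le.trans (ih (r a' + k - r b') ?_ hb' ?_ hzb' hz' hbd ?_)
    · have := hk b' hb'
      omega
    · intro s hs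
      have := hk s hs
      have := hk b' hb'
      omega
    · refine hyz.congr fun i ↦ ?_
      rw [← φ.map_add, sub_add_cancel]
  · rw [tendsto_atTop] at hbd
    push Not at hbd
    obtain ⟨c, hc⟩ := hbd
    have hc' : ∀ᶠ i in (u : Filter ι), t i - τ i ∈ Icc 0 c := by
      filter_upwards [hc, hτt] with i h1 h2
      exact ⟨by linarith, h1.le⟩
    obtain ⟨d, -, hd⟩ := isCompact_Icc.ultrafilter_le_nhds' (u.map fun i ↦ t i - τ i) hc'
    have hd' : Tendsto (fun i ↦ t i - τ i) u (𝓝 d) := hd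
    have h1 : Tendsto (fun i ↦ φ (t i - τ i) (φ (τ i) (y i))) u (𝓝 (φ d z')) :=
      ((φ.continuous continuous_fst continuous_snd).tendsto (d, z')).comp (hd'.prodMk_nhds hz')
    have h2 : z = φ d z' := tendsto_nhds_unique hyz (h1.congr fun i ↦ by
      rw [← φ.map_add, sub_add_cancel])
    rw [tendsto_nhds_unique hz (h2 ▸ tendsto_atBot_map d hza')]

/-- Orbit segments of unbounded length lead from points near `x` to points near `z` only if the end
of the orbit of `x` has at most the rank of the start of the orbit of `z`. -/
theorem rank_le_of_tendsto (h : IsRankedFlow φ S r) {ι : Type*} {l : Filter ι} [l.NeBot]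
    {x z a b : X} {y : ι → X} {t : ι → ℝ} (hz : Tendsto (φ · z) atBot (𝓝 a))
    (hb : b ∈ S) (hx : Tendsto (φ · x) atTop (𝓝 b)) (hy : Tendsto y l (𝓝 x))
    (ht : Tendsto t l atTop) (hyz : Tendsto (fun i ↦ φ (t i) (y i)) l (𝓝 z)) : r b ≤ r a := by
  obtain ⟨N, hN⟩ := (h.finite.image r).bddAbove
  have hu := Ultrafilter.of_le l
  exact h.rank_le_of_tendsto_ultrafilter (Ultrafilter.of l) hz N hb
    (fun s hs ↦ (hN (mem_image_of_mem r hs)).trans (by omega)) hx (hy.mono_left hu)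
    (ht.mono_left hu) (hyz.mono_left hu)

/-- By finiteness, ultrafilter-most nearby orbits start at one fixed point `c`. Running them back
for long times gives points near `c` that return to near `x`, so `x` starts at rank at least `r c`.
The curried filter expresses that the time is chosen after the point. -/
theorem isClosed_upperSet (h : IsRankedFlow φ S r) (k : ℕ) : IsClosed (upperSet φ S r k) := by
  refine isClosed_iff_ultrafilter.2 fun x u hux hu ↦ ?_
  have hu' : (⋃ a ∈ S, {y | Tendsto (φ · y) atBot (𝓝 a) ∧ k ≤ r a}) ∈ u :=
    Filter.mem_of_superset hu fun y ⟨a, ha, hy⟩ ↦ mem_biUnion ha hy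
  obtain ⟨c, hc, hcu⟩ := (Ultrafilter.finite_biUnion_mem_iff h.finite).1 hu'
  obtain ⟨a, ha, hxa⟩ := h.alpha x
  have hkc : k ≤ r c := by
    obtain ⟨y, hy⟩ := u.nonempty_of_mem hcu
    exact hy.2
  refine ⟨a, ha, hxa, hkc.trans ?_⟩
  have := neBot_curry (u : Filter X) (atTop : Filter ℝ)
  refine h.rank_le_of_tendsto (l := (u : Filter X).curry (atTop : Filter ℝ))
    (y := fun p ↦ φ (-p.2) p.1) (t := fun p ↦ p.2) hxa hc (h.tendsto_of_mem hc _) ?_ ?_ ?_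
  · refine fun O hO ↦ eventually_curry_iff.2 ?_
    filter_upwards [hcu] with y hy
    exact (hy.1.comp tendsto_neg_atTop_atBot).eventually_mem hO
  · exact fun O hO ↦ eventually_curry_iff.2 (Eventually.of_forall fun y ↦ hO)
  · refine fun O hO ↦ eventually_curry_iff.2 ?_
    filter_upwards [hux hO] with y hy
    refine Eventually.of_forall fun t ↦ ?_
    simpa [← φ.map_add] using hy

theorem isClosed_lowerSet (h : IsRankedFlow φ S r) (k : ℕ) : IsClosed (lowerSet φ S r k) := by
  refine isClosed_iff_ultrafilter.2 fun x u hux hu ↦ ?_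
  have hu' : (⋃ a ∈ S, {y | Tendsto (φ · y) atTop (𝓝 a) ∧ r a < k}) ∈ u :=
    Filter.mem_of_superset hu fun y ⟨a, ha, hy⟩ ↦ mem_biUnion ha hy
  obtain ⟨c, hc, hcu⟩ := (Ultrafilter.finite_biUnion_mem_iff h.finite).1 hu'
  obtain ⟨b, hb, hxb⟩ := h.omega x
  have hkc : r c < k := by
    obtain ⟨y, hy⟩ := u.nonempty_of_mem hcu
    exact hy.2
  refine ⟨b, hb, hxb, lt_of_le_of_lt ?_ hkc⟩
  have := neBot_curry (u : Filter X) (atTop : Filter ℝ)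
  refine h.rank_le_of_tendsto (l := (u : Filter X).curry (atTop : Filter ℝ))
    (y := fun p ↦ p.1) (t := fun p ↦ p.2) (h.tendsto_of_mem hc _) hb hxb ?_ ?_ ?_
  · refine fun O hO ↦ eventually_curry_iff.2 ?_
    filter_upwards [hux hO] with y hy
    exact Eventually.of_forall fun t ↦ hy
  · exact fun O hO ↦ eventually_curry_iff.2 (Eventually.of_forall fun y ↦ hO)
  · refine fun O hO ↦ eventually_curry_iff.2 ?_
    filter_upwards [hcu] with y hy
    exact hy.1.eventually_mem hO

/-- Otherwise segments of unbounded length decrease `F`. Pass to limits `x`, `z` of their endpoints: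
if the orbit of `x` ends below rank `k`, then `F = 0` near `x`; if not, `z` starts at rank at least
`k` and `F = 1` near `z`. Neither permits a decrease. -/
theorem exists_forall_le_map (h : IsRankedFlow φ S r) {k : ℕ} {F : X → ℝ}
    (hF : ∀ x, F x ∈ Icc 0 1) (hA : ∀ x ∈ upperSet φ S r k, ∀ᶠ y in 𝓝 x, F y = 1)
    (hR : ∀ x ∈ lowerSet φ S r k, ∀ᶠ y in 𝓝 x, F y = 0) :
    ∃ T₀ : ℝ, ∀ T ≥ T₀, ∀ x, F x ≤ F (φ T x) := by
  by_contra! hne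
  choose t ht y hy using fun n : ℕ ↦ hne n
  let u : Ultrafilter ℕ := Ultrafilter.of atTop
  have hu : (u : Filter ℕ) ≤ atTop := Ultrafilter.of_le _
  set x := (u.map y).lim
  have hx : Tendsto y u (𝓝 x) := (u.map y).le_nhds_lim
  set z := (u.map fun i ↦ φ (t i) (y i)).lim
  have hz : Tendsto (fun i ↦ φ (t i) (y i)) u (𝓝 z) :=
    (u.map fun i ↦ φ (t i) (y i)).le_nhds_lim
  have htt : Tendsto t u atTop :=
    (tendsto_atTop_mono ht tendsto_natCast_atTop_atTop).mono_left hu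
  obtain ⟨a, ha, hza⟩ := h.alpha z
  obtain ⟨b, hb, hxb⟩ := h.omega x
  have hle := h.rank_le_of_tendsto hza hb hxb hx htt hz
  by_cases hk : r b < k
  · obtain ⟨n, hn⟩ := (hx.eventually (hR x ⟨b, hb, hxb, hk⟩)).exists
    have := hy n
    rw [hn] at this
    exact absurd (hF (φ (t n) (y n))).1 (not_le.2 this)
  · obtain ⟨n, hn⟩ := (hz.eventually (hA z ⟨a, ha, hza, by omega⟩)).exists
    have := hy n
    rw [hn] at this
    exact absurd (hF (y n)).2 (not_le.2 this)

end IsRankedFlow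

end RankedFlow

/-! ### Smoothness of superposition operators on continuous functions -/

section Superposition

variable {X : Type} [TopologicalSpace X] [CompactSpace X] {E F : Type}
  [NormedAddCommGroup E] [NormedSpace ℝ E] [NormedAddCommGroup F] [NormedSpace ℝ F]

set_option synthInstance.maxHeartbeats 400000 in
/-- Pointwise application of a continuous family of continuous linear maps. -/
def pointwiseApply (X E F : Type) [TopologicalSpace X] [CompactSpace X]
    [NormedAddCommGroup E] [NormedSpace ℝ E] [NormedAddCommGroup F] [NormedSpace ℝ F] :
    C(X, E →L[ℝ] F) →L[ℝ] C(X, E) →L[ℝ] C(X, F) :=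
  LinearMap.mkContinuous₂
    (LinearMap.mk₂ ℝ (fun (A : C(X, E →L[ℝ] F)) (h : C(X, E)) ↦
      (⟨fun x ↦ A x (h x), by fun_prop⟩ : C(X, F)))
      (fun A B h ↦ by ext; simp) (fun c A h ↦ by ext; simp)
      (fun A g h ↦ by ext; simp) (fun c A h ↦ by ext; simp)) 1 (fun A h ↦ by
        rw [one_mul, ContinuousMap.norm_le _ (by positivity)]
        intro x
        exact ((A x).le_opNorm (h x)).trans (by
          gcongr
          · exact A.norm_coe_le_norm x
          · exact h.norm_coe_le_norm x))

set_option synthInstance.maxHeartbeats 400000 in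
theorem hasFDerivAt_continuousMap_comp (w : C(E, F)) (w' : C(E, E →L[ℝ] F))
    (hw : ∀ x, HasFDerivAt w (w' x) x) (u : C(X, E)) :
    HasFDerivAt (fun u : C(X, E) ↦ w.comp u) (pointwiseApply X E F (w'.comp u)) u := by
  rw [hasFDerivAt_iff_isLittleO, Asymptotics.isLittleO_iff]
  intro ε hε
  have hK : IsCompact (range u) := isCompact_range u.continuous
  have hunif := hK.uniformContinuousAt_of_continuousAt w' (fun a _ ↦ w'.continuous.continuousAt)
    (Metric.dist_mem_uniformity hε)
  obtain ⟨δ, hδ, hδ'⟩ := Metric.mem_uniformity_dist.1 hunif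
  filter_upwards [Metric.ball_mem_nhds u hδ] with u' hu'
  rw [ContinuousMap.norm_le _ (by positivity)]
  intro x
  have hx : dist (u' x) (u x) < δ := (ContinuousMap.dist_apply_le_dist x).trans_lt hu'
  have hmv := (convex_ball (u x) δ).norm_image_sub_le_of_norm_hasFDerivWithin_le' (f := w)
    (f' := w') (φ := w' (u x)) (C := ε) (fun y _ ↦ (hw y).hasFDerivWithinAt)
    (fun y hy ↦ by
      have := hδ' (show dist (u x) y < δ by rwa [dist_comm]) (mem_range_self x)
      simp only [mem_ofPred_eq] at this
      rw [← dist_eq_norm, dist_comm]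
      exact this.le) (Metric.mem_ball_self hδ) (show u' x ∈ Metric.ball (u x) δ from hx)
  refine hmv.trans ?_
  gcongr
  exact (u' - u).norm_coe_le_norm x

set_option synthInstance.maxHeartbeats 400000 in
theorem contDiff_continuousMap_comp_nat (n : ℕ) : ∀ {F : Type} [NormedAddCommGroup F]
    [NormedSpace ℝ F] (w : C(E, F)), ContDiff ℝ n w →
    ContDiff ℝ n (fun u : C(X, E) ↦ w.comp u) := by
  induction n with
  | zero =>
    intro F _ _ w _
    exact contDiff_zero.2 w.continuous_postcomp
  | succ n ih =>
    intro F _ _ w hw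
    obtain ⟨w', hw', hd⟩ := contDiff_succ_iff_hasFDerivAt.1 hw
    rw [Nat.cast_add, Nat.cast_one]
    -- The derivative is again a superposition operator, with values in `E →L[ℝ] F`; this is why the
    -- induction ranges over all target spaces.
    exact contDiff_succ_iff_hasFDerivAt.2 ⟨_, (pointwiseApply X E F).contDiff.comp
      (ih ⟨w', hw'.continuous⟩ hw'), hasFDerivAt_continuousMap_comp w ⟨w', hw'.continuous⟩ hd⟩

/-- The superposition operator `u ↦ w ∘ u` of a smooth function is smooth. -/
theorem contDiff_continuousMap_comp (w : C(E, F)) (hw : ContDiff ℝ ∞ w) :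
    ContDiff ℝ ∞ (fun u : C(X, E) ↦ w.comp u) :=
  contDiff_infty.2 fun n ↦ contDiff_continuousMap_comp_nat n w (contDiff_infty.1 hw n)

end Superposition

/-! ### Primitives and integrals depending on parameters -/

section Primitive

theorem continuous_extend {Y : Type*} [TopologicalSpace Y] {a b : ℝ} (h : a ≤ b)
    (u : C(Icc a b, Y)) :
    Continuous fun s ↦ u (projIcc a b h s) :=
  u.continuous.comp continuous_projIcc

variable {E F : Type} [NormedAddCommGroup E] [NormedSpace ℝ E]
  [NormedAddCommGroup F] [NormedSpace ℝ F]

/-- The primitive of a continuous function on `[a, b]` that vanishes at `c`. -/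
def primitive {a b : ℝ} (h : a ≤ b) (c : Icc a b) : C(Icc a b, F) →L[ℝ] C(Icc a b, F) :=
  LinearMap.mkContinuous
    { toFun := fun u ↦ ⟨fun s ↦ ∫ σ in (c : ℝ)..s, u (projIcc a b h σ),
        (intervalIntegral.continuous_primitive
          (fun _ _ ↦ (continuous_extend h u).intervalIntegrable _ _) _).comp
          continuous_subtype_val⟩
      map_add' := fun u v ↦ by
        ext s
        exact intervalIntegral.integral_add ((continuous_extend h u).intervalIntegrable _ _)
          ((continuous_extend h v).intervalIntegrable _ _)
      map_smul' := fun k u ↦ by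
        ext s
        exact intervalIntegral.integral_smul k _ } (b - a) (fun u ↦ by
    rw [ContinuousMap.norm_le _ (mul_nonneg (sub_nonneg.2 h) (norm_nonneg u))]
    intro s
    refine (intervalIntegral.norm_integral_le_of_norm_le_const
      (fun σ _ ↦ u.norm_coe_le_norm (projIcc a b h σ))).trans ?_
    rw [mul_comm]
    gcongr
    rw [abs_le]
    constructor <;> linarith [s.2.1, s.2.2, c.2.1, c.2.2])

theorem primitive_apply {a b : ℝ} (h : a ≤ b) (c : Icc a b) (u : C(Icc a b, F)) (s : Icc a b) :
    primitive h c u s = ∫ σ in (c : ℝ)..s, u (projIcc a b h σ) := rfl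

/-- The constant functions as a continuous linear map. -/
def constCLM (X E : Type) [TopologicalSpace X] [CompactSpace X] [NormedAddCommGroup E]
    [NormedSpace ℝ E] : E →L[ℝ] C(X, E) :=
  LinearMap.mkContinuous
    { toFun := fun x ↦ ContinuousMap.const X x
      map_add' := fun x y ↦ rfl
      map_smul' := fun k x ↦ rfl } 1 (fun x ↦ by
    rw [one_mul, ContinuousMap.norm_le _ (norm_nonneg x)]
    exact fun _ ↦ le_rfl)

theorem constCLM_apply {X : Type} [TopologicalSpace X] [CompactSpace X] (x : E) (s : X) :
    constCLM X E x s = x := rfl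

/-- An integral of a smooth function depends smoothly on parameters. -/
theorem contDiff_intervalIntegral {a b : ℝ} (h : a ≤ b) {f : E × ℝ → F} (hf : ContDiff ℝ ∞ f) :
    ContDiff ℝ ∞ (fun x ↦ ∫ s in a..b, f (x, s)) := by
  let k : C(Icc a b, E × ℝ) := ⟨fun s ↦ (0, s), by fun_prop⟩
  have h1 : ContDiff ℝ ∞ (fun x : E ↦ primitive (F := F) h ⟨a, left_mem_Icc.2 h⟩
      ((⟨f, hf.continuous⟩ : C(E × ℝ, F)).comp (constCLM (Icc a b) (E × ℝ) (x, 0) + k))) := by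
    refine (primitive (F := F) h ⟨a, left_mem_Icc.2 h⟩).contDiff.comp
      ((contDiff_continuousMap_comp (⟨f, hf.continuous⟩ : C(E × ℝ, F)) hf).comp ?_)
    exact ((constCLM (Icc a b) (E × ℝ)).contDiff.comp (contDiff_id.prodMk contDiff_const)).add
      contDiff_const
  have h2 := (ContinuousMap.evalCLM (M := F) ℝ (⟨b, right_mem_Icc.2 h⟩ : Icc a b)).contDiff
    (n := ∞) |>.comp h1
  convert h2 using 2 with x
  simp only [Function.comp_apply, ContinuousMap.evalCLM_apply, primitive_apply]
  refine intervalIntegral.integral_congr fun s hs ↦ ?_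
  rw [uIcc_of_le h] at hs
  simp [constCLM_apply, k, projIcc_of_mem h hs]

end Primitive

/-! ### Smooth dependence for the integral equation of an ODE -/

section LocalFlow

variable {E : Type} [NormedAddCommGroup E] [NormedSpace ℝ E]

theorem neg_one_le_one_real : (-1 : ℝ) ≤ 1 := by norm_num

/-- The equation `u (s) = x + τ ∫₀ˢ w (u)` on `[-1, 1]` has a solution `u` that depends smoothly on
`x` and `τ` near `τ = 0`. -/
theorem exists_contDiffAt_integralEquation [CompleteSpace E] {w : E → E} (hw : ContDiff ℝ ∞ w)
    (x₀ : E) :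
    ∃ U : E × ℝ → C(Icc (-1 : ℝ) 1, E), ContDiffAt ℝ ∞ U (x₀, 0) ∧
      U (x₀, 0) = ContinuousMap.const _ x₀ ∧
      ∀ᶠ p in 𝓝 (x₀, (0 : ℝ)), ∀ s : Icc (-1 : ℝ) 1,
        U p s = p.1 + p.2 • ∫ σ in (0 : ℝ)..s, w (U p (projIcc (-1) 1 neg_one_le_one_real σ)) := by
  let J : C(Icc (-1 : ℝ) 1, E) →L[ℝ] C(Icc (-1 : ℝ) 1, E) :=
    primitive neg_one_le_one_real ⟨0, by norm_num, by norm_num⟩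
  let W : C(E, E) := ⟨w, hw.continuous⟩
  let N : C(Icc (-1 : ℝ) 1, E) → C(Icc (-1 : ℝ) 1, E) := fun u ↦ W.comp u
  have hN : ContDiff ℝ ∞ N := contDiff_continuousMap_comp W hw
  let c : E →L[ℝ] C(Icc (-1 : ℝ) 1, E) := constCLM _ _
  -- Solutions with data `(x, τ)` are exactly the preimages of `(x, τ, 0)`, so a smooth local
  -- inverse of `Ψ` solves the equation.
  let Ψ : E × ℝ × C(Icc (-1 : ℝ) 1, E) → E × ℝ × C(Icc (-1 : ℝ) 1, E) :=
    fun p ↦ (p.1, p.2.1, p.2.2 - c p.1 - p.2.1 • J (N p.2.2))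
  have hΨ : ContDiff ℝ ∞ Ψ := by
    refine contDiff_fst.prodMk (contDiff_snd.fst.prodMk ((contDiff_snd.snd.sub
      (c.contDiff.comp contDiff_fst)).sub (contDiff_snd.fst.smul
      (J.contDiff.comp (hN.comp contDiff_snd.snd)))))
  let p₀ : E × ℝ × C(Icc (-1 : ℝ) 1, E) := (x₀, 0, c x₀)
  let j : C(Icc (-1 : ℝ) 1, E) := J (N (c x₀))
  -- At `τ = 0` the nonlinear term is differentiated only through its factor `τ`. The derivative is
  -- therefore unipotent, and changing the signs of the off-diagonal terms inverts it.
  let Ψ' : (E × ℝ × C(Icc (-1 : ℝ) 1, E)) ≃L[ℝ] (E × ℝ × C(Icc (-1 : ℝ) 1, E)) :=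
    ContinuousLinearEquiv.equivOfInverse
      ((ContinuousLinearMap.fst ℝ _ _).prod (((ContinuousLinearMap.fst ℝ _ _).comp
        (ContinuousLinearMap.snd ℝ _ _)).prod
        ((ContinuousLinearMap.snd ℝ _ _).comp (ContinuousLinearMap.snd ℝ _ _)
          - c.comp (ContinuousLinearMap.fst ℝ _ _)
          - ((ContinuousLinearMap.fst ℝ _ _).comp (ContinuousLinearMap.snd ℝ _ _)).smulRight j)))
      ((ContinuousLinearMap.fst ℝ _ _).prod (((ContinuousLinearMap.fst ℝ _ _).comp
        (ContinuousLinearMap.snd ℝ _ _)).prod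
        ((ContinuousLinearMap.snd ℝ _ _).comp (ContinuousLinearMap.snd ℝ _ _)
          + c.comp (ContinuousLinearMap.fst ℝ _ _)
          + ((ContinuousLinearMap.fst ℝ _ _).comp (ContinuousLinearMap.snd ℝ _ _)).smulRight j)))
      (fun p ↦ by
        refine Prod.ext rfl (Prod.ext rfl ?_)
        simp
        abel)
      (fun p ↦ by
        refine Prod.ext rfl (Prod.ext rfl ?_)
        simp
        abel)
  have hd : HasFDerivAt Ψ (Ψ' : (E × ℝ × C(Icc (-1 : ℝ) 1, E)) →L[ℝ] _) p₀ := by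
    have h1 : HasFDerivAt (fun p : E × ℝ × C(Icc (-1 : ℝ) 1, E) ↦ p.2.1)
        ((ContinuousLinearMap.fst ℝ _ _).comp (ContinuousLinearMap.snd ℝ _ _)) p₀ :=
      hasFDerivAt_snd.fst
    have h2 : HasFDerivAt (fun p : E × ℝ × C(Icc (-1 : ℝ) 1, E) ↦ p.2.2)
        ((ContinuousLinearMap.snd ℝ _ _).comp (ContinuousLinearMap.snd ℝ _ _)) p₀ :=
      hasFDerivAt_snd.snd
    have h3 := (J.hasFDerivAt (x := N p₀.2.2)).comp p₀
      (((hN.differentiable (by simp)).differentiableAt (x := p₀.2.2)).hasFDerivAt.comp p₀ h2)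
    have h4 := h1.smul h3
    have h5 := (h2.sub (c.hasFDerivAt.comp p₀ hasFDerivAt_fst)).sub h4
    refine (hasFDerivAt_fst.prodMk (h1.prodMk h5)).congr_fderiv ?_
    ext p <;> simp [Ψ', p₀, j]
  have hΨp : Ψ p₀ = (x₀, 0, 0) := by simp [Ψ, p₀]
  have hc := hΨ.contDiffAt (x := p₀)
  have hne : (∞ : WithTop ℕ∞) ≠ 0 := by simp
  let L := hc.localInverse hd hne
  have hL : ContDiffAt ℝ ∞ L (x₀, 0, 0) := hΨp ▸ hc.to_localInverse hd hne
  have hLp : L (x₀, 0, 0) = p₀ := by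
    rw [← hΨp]
    exact hc.localInverse_apply_image hd hne
  have hst := hc.hasStrictFDerivAt' hd hne
  have hinv : ∀ᶠ q in 𝓝 (x₀, (0 : ℝ), (0 : C(Icc (-1 : ℝ) 1, E))), Ψ (L q) = q := by
    rw [← hΨp]
    exact hst.eventually_right_inverse
  let ι : E × ℝ → E × ℝ × C(Icc (-1 : ℝ) 1, E) := fun p ↦ (p.1, p.2, 0)
  have hι : ContDiff ℝ ∞ ι := contDiff_fst.prodMk (contDiff_snd.prodMk contDiff_const)
  refine ⟨fun p ↦ (L (ι p)).2.2, ?_, ?_, ?_⟩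
  · have hL' : ContDiffAt ℝ ∞ L (ι (x₀, 0)) := hL
    exact (contDiff_snd.snd.contDiffAt).comp _ (hL'.comp _ hι.contDiffAt)
  · change (L (x₀, 0, 0)).2.2 = _
    rw [hLp]
    rfl
  · have hιt : Tendsto ι (𝓝 (x₀, 0)) (𝓝 (x₀, 0, 0)) := hι.continuous.tendsto _
    filter_upwards [hιt.eventually hinv] with p hp s
    have e1 : (L (ι p)).1 = p.1 := congrArg Prod.fst hp
    have e2 : (L (ι p)).2.1 = p.2 := congrArg (fun q ↦ q.2.1) hp
    have e3 : (L (ι p)).2.2 - c (L (ι p)).1 - (L (ι p)).2.1 • J (N (L (ι p)).2.2) = 0 :=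
      congrArg (fun q ↦ q.2.2) hp
    rw [e1, e2, sub_sub, sub_eq_zero] at e3
    exact DFunLike.congr_fun e3 s

end LocalFlow

/-! ### Local integral curves on the manifold -/

section ManifoldFlow

variable {n : ℕ} {M : Type*} [TopologicalSpace M] [ChartedSpace (EuclideanSpace ℝ (Fin n)) M]

/-- The vector field `v` in the chart at `x₀`. -/
def chartField (v : (x : M) → TangentSpace (𝓡 n) x) (x₀ : M) (y : EuclideanSpace ℝ (Fin n)) :
    EuclideanSpace ℝ (Fin n) :=
  mfderiv (𝓡 n) 𝓘(ℝ, EuclideanSpace ℝ (Fin n)) (extChartAt (𝓡 n) x₀)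
    ((extChartAt (𝓡 n) x₀).symm y) (v ((extChartAt (𝓡 n) x₀).symm y))

variable [IsManifold (𝓡 n) ∞ M] {v : (x : M) → TangentSpace (𝓡 n) x}

theorem contDiffOn_chartField
    (hv : ContMDiff (𝓡 n) (𝓡 n).tangent ∞ (fun x ↦ (⟨x, v x⟩ : TangentBundle (𝓡 n) M))) (x₀ : M) :
    ContDiffOn ℝ ∞ (chartField v x₀) (extChartAt (𝓡 n) x₀).target := by
  rw [← contMDiffOn_iff_contDiffOn]
  have h1 : ContMDiffOn 𝓘(ℝ, EuclideanSpace ℝ (Fin n)) (𝓡 n).tangent ∞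
      (fun y ↦ (⟨(extChartAt (𝓡 n) x₀).symm y, v ((extChartAt (𝓡 n) x₀).symm y)⟩ :
        TangentBundle (𝓡 n) M)) (extChartAt (𝓡 n) x₀).target :=
    hv.comp_contMDiffOn (contMDiffOn_extChartAt_symm x₀)
  have hmem : ∀ y ∈ (extChartAt (𝓡 n) x₀).target,
      (extChartAt (𝓡 n) x₀).symm y ∈ (chartAt (EuclideanSpace ℝ (Fin n)) x₀).source := fun y hy ↦ by
    rw [← extChartAt_source (𝓡 n)]
    exact (extChartAt (𝓡 n) x₀).map_target hy
  set e := trivializationAt (EuclideanSpace ℝ (Fin n)) (TangentSpace (𝓡 n) (M := M)) x₀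
  have h2 := ((e.contMDiffOn_iff (fun y hy ↦ e.mem_source.2 (by simpa [e] using hmem y hy))).1 h1).2
  refine h2.congr fun y hy ↦ ?_
  have hx := hmem y hy
  have h3 := DFunLike.congr_fun (TangentBundle.continuousLinearMapAt_trivializationAt
    (I := 𝓡 n) hx) (v ((extChartAt (𝓡 n) x₀).symm y))
  have h4 := congrFun (e.coe_linearMapAt_of_mem (R := ℝ)
    (b := (extChartAt (𝓡 n) x₀).symm y) (by simpa [e] using hx)) (v ((extChartAt (𝓡 n) x₀).symm y))
  exact h3.symm.trans h4

theorem hasMFDerivAt_symm_comp_of_hasDerivAt {x₀ : M} {u : ℝ → EuclideanSpace ℝ (Fin n)} {t : ℝ}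
    (hu : HasDerivAt u (chartField v x₀ (u t)) t) (ht : u t ∈ (extChartAt (𝓡 n) x₀).target) :
    HasMFDerivAt 𝓘(ℝ, ℝ) (𝓡 n) (fun s ↦ (extChartAt (𝓡 n) x₀).symm (u s)) t
      ((1 : ℝ →L[ℝ] ℝ).smulRight (v ((extChartAt (𝓡 n) x₀).symm (u t)))) := by
  have h1 : MDifferentiableAt 𝓘(ℝ, EuclideanSpace ℝ (Fin n)) (𝓡 n)
      (extChartAt (𝓡 n) x₀).symm (u t) :=
    ((contMDiffOn_extChartAt_symm (n := ∞) x₀).contMDiffAt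
      ((isOpen_extChartAt_target x₀).mem_nhds ht)).mdifferentiableAt (by simp)
  have h2 := h1.hasMFDerivAt.comp t hu.hasFDerivAt.hasMFDerivAt
  have h3 := mfderivWithin_extChartAt_symm_comp_mfderiv_extChartAt (I := 𝓡 n) ht
  rw [ModelWithCorners.range_eq_univ, mfderivWithin_univ] at h3
  have h4 := DFunLike.congr_fun h3 (v ((extChartAt (𝓡 n) x₀).symm (u t)))
  refine h2.congr_mfderiv ?_
  refine ContinuousLinearMap.ext_ring ?_
  exact (congrArg (mfderiv 𝓘(ℝ, EuclideanSpace ℝ (Fin n)) (𝓡 n) (extChartAt (𝓡 n) x₀).symm (u t))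
    (one_smul ℝ (chartField v x₀ (u t)))).trans (h4.trans (one_smul ℝ _).symm)

theorem exists_contDiff_eqOn_ball {E F : Type*} [NormedAddCommGroup E] [NormedSpace ℝ E]
    [HasContDiffBump E] [NormedAddCommGroup F] [NormedSpace ℝ F] {f : E → F} {s : Set E} {x₀ : E}
    [FiniteDimensional ℝ E]
    (hf : ContDiffOn ℝ ∞ f s) (hs : IsOpen s) (hx : x₀ ∈ s) :
    ∃ g : E → F, ContDiff ℝ ∞ g ∧ ∃ r > 0, Metric.ball x₀ r ⊆ s ∧ EqOn g f (Metric.ball x₀ r) := by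
  obtain ⟨R, hR, hRs⟩ := Metric.nhds_basis_closedBall.mem_iff.1 (hs.mem_nhds hx)
  let χ : ContDiffBump x₀ := ⟨R / 2, R, by positivity, by linarith⟩
  refine ⟨fun x ↦ χ x • f x, contDiff_iff_contDiffAt.2 fun x ↦ ?_, R / 2, by positivity,
    (Metric.ball_subset_closedBall.trans
      (Metric.closedBall_subset_closedBall (by linarith))).trans hRs, fun x hx ↦ ?_⟩
  · by_cases hxR : x ∈ Metric.closedBall x₀ R
    · exact χ.contDiffAt.smul (hf.contDiffAt (hs.mem_nhds (hRs hxR)))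
    · refine (contDiffAt_const (c := (0 : F))).congr_of_eventuallyEq ?_
      filter_upwards [Metric.isClosed_closedBall.isOpen_compl.mem_nhds hxR] with y hy
      have : χ y = 0 := χ.zero_of_le_dist (not_le.1 (show ¬ dist y x₀ ≤ R from hy)).le
      simp [this]
  · have : χ x = 1 := χ.one_of_mem_closedBall (Metric.ball_subset_closedBall hx)
    simp [this]

/-- Local integral curves that start near `x₀`, in a form that depends smoothly on the starting
point and on the length of the time interval. -/
theorem exists_local_integralCurves
    (hv : ContMDiff (𝓡 n) (𝓡 n).tangent ∞ (fun x ↦ (⟨x, v x⟩ : TangentBundle (𝓡 n) M))) (x₀ : M) :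
    ∃ U : EuclideanSpace ℝ (Fin n) × ℝ → C(Icc (-1 : ℝ) 1, EuclideanSpace ℝ (Fin n)),
      ContDiffAt ℝ ∞ U (extChartAt (𝓡 n) x₀ x₀, 0) ∧
      ∀ᶠ p in 𝓝 (extChartAt (𝓡 n) x₀ x₀, (0 : ℝ)),
        (∀ s, U p s ∈ (extChartAt (𝓡 n) x₀).target) ∧
        U p ⟨0, by norm_num, by norm_num⟩ = p.1 ∧
        (p.2 = 0 → ∀ s, U p s = p.1) ∧
        (p.2 ≠ 0 → IsMIntegralCurveOn (fun t ↦ (extChartAt (𝓡 n) x₀).symm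
          (U p (projIcc (-1) 1 neg_one_le_one_real (t / p.2)))) v (Ioo (-|p.2|) |p.2|)) := by
  -- The integral equation needs a field on the whole space; the cut-off field is harmless because
  -- solutions near the constant one stay in the ball where it is unchanged.
  obtain ⟨w, hw, r, hr, hrs, hwr⟩ := exists_contDiff_eqOn_ball (contDiffOn_chartField hv x₀)
    (isOpen_extChartAt_target x₀) (mem_extChartAt_target x₀)
  obtain ⟨U, hU, hU0, hUeq⟩ := exists_contDiffAt_integralEquation hw (extChartAt (𝓡 n) x₀ x₀)
  refine ⟨U, hU, ?_⟩
  have hnear : ∀ᶠ p in 𝓝 (extChartAt (𝓡 n) x₀ x₀, (0 : ℝ)), dist (U p)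
      (ContinuousMap.const _ (extChartAt (𝓡 n) x₀ x₀)) < r := by
    have := hU.continuousAt
    rw [ContinuousAt, hU0] at this
    exact this.eventually (Metric.ball_mem_nhds _ hr)
  filter_upwards [hUeq, hnear] with p hp hpr
  have hball : ∀ s, U p s ∈ Metric.ball (extChartAt (𝓡 n) x₀ x₀) r := fun s ↦
    (ContinuousMap.dist_apply_le_dist s).trans_lt hpr
  refine ⟨fun s ↦ hrs (hball s), ?_, ?_, ?_⟩
  · rw [hp]
    simp
  · intro h0 s
    rw [hp, h0]
    simp
  · intro h0 t ht
    refine HasMFDerivAt.hasMFDerivWithinAt ?_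
    have habs : 0 < |p.2| := abs_pos.2 h0
    have ht1 : t / p.2 ∈ Ioo (-1 : ℝ) 1 := by
      rw [mem_Ioo, ← abs_lt, abs_div, div_lt_one habs]
      exact abs_lt.2 ht
    refine hasMFDerivAt_symm_comp_of_hasDerivAt
      (u := fun t ↦ U p (projIcc (-1) 1 neg_one_le_one_real (t / p.2))) ?_ (hrs (hball _))
    have hcont : Continuous fun σ ↦ w (U p (projIcc (-1) 1 neg_one_le_one_real σ)) :=
      hw.continuous.comp (continuous_extend neg_one_le_one_real (U p))
    have h1 : HasDerivAt (fun s ↦ p.1 + p.2 • ∫ σ in (0 : ℝ)..s,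
        w (U p (projIcc (-1) 1 neg_one_le_one_real σ)))
        (p.2 • w (U p (projIcc (-1) 1 neg_one_le_one_real (t / p.2)))) (t / p.2) :=
      ((intervalIntegral.integral_hasDerivAt_right (hcont.intervalIntegrable _ _)
        (hcont.stronglyMeasurableAtFilter _ _) hcont.continuousAt).const_smul p.2).const_add p.1
    -- Rescaling time by `p.2`, of either sign, turns the integral equation into the ODE of `v`.
    have h2 := h1.scomp t ((hasDerivAt_id t).div_const p.2)
    rw [smul_smul, one_div, inv_mul_cancel₀ h0, one_smul, hwr (hball _)] at h2
    refine h2.congr_of_eventuallyEq ?_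
    have hev : ∀ᶠ t' in 𝓝 t, t' / p.2 ∈ Ioo (-1 : ℝ) 1 :=
      (continuous_id.div_const p.2).continuousAt.eventually_mem (isOpen_Ioo.mem_nhds ht1)
    filter_upwards [hev] with t' ht'
    have h3 := hp (projIcc (-1) 1 neg_one_le_one_real (t' / p.2))
    rw [h3, projIcc_of_mem neg_one_le_one_real (Ioo_subset_Icc_self ht')]
    rfl

end ManifoldFlow

/-! ### The global smooth flow -/

section GlobalFlow

variable {n : ℕ} {M : Type*} [TopologicalSpace M] [T2Space M] [CompactSpace M]
  [ChartedSpace (EuclideanSpace ℝ (Fin n)) M] [IsManifold (𝓡 n) ∞ M]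
  {v : (x : M) → TangentSpace (𝓡 n) x}

theorem exists_isMIntegralCurve
    (hv : ContMDiff (𝓡 n) (𝓡 n).tangent ∞ (fun x ↦ (⟨x, v x⟩ : TangentBundle (𝓡 n) M))) (x : M) :
    ∃ γ : ℝ → M, γ 0 = x ∧ IsMIntegralCurve γ v := by
  have hv1 : ContMDiff (𝓡 n) (𝓡 n).tangent 1 (fun x ↦ (⟨x, v x⟩ : TangentBundle (𝓡 n) M)) :=
    hv.of_le (by simp)
  have : IsManifold (𝓡 n) 1 M := .of_le (n := ∞) (by simp)
  have hloc : ∀ x₀ : M, ∀ᶠ q in 𝓝 (x₀, (0 : ℝ)), 0 < q.2 →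
      ∃ γ : ℝ → M, γ 0 = q.1 ∧ IsMIntegralCurveOn γ v (Ioo (-q.2) q.2) := by
    intro x₀
    obtain ⟨U, -, hU⟩ := exists_local_integralCurves hv x₀
    have hcont : ContinuousAt (fun q : M × ℝ ↦ (extChartAt (𝓡 n) x₀ q.1, q.2)) (x₀, 0) :=
      ((continuousAt_extChartAt (I := 𝓡 n) x₀).comp continuousAt_fst).prodMk continuousAt_snd
    have hsrc : ∀ᶠ q in 𝓝 (x₀, (0 : ℝ)), q.1 ∈ (extChartAt (𝓡 n) x₀).source :=
      continuousAt_fst.eventually_mem (extChartAt_source_mem_nhds x₀)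
    filter_upwards [hcont.eventually hU, hsrc] with q hq hqs hq0
    have hc : IsMIntegralCurveOn _ v (Ioo (-|q.2|) |q.2|) := hq.2.2.2 hq0.ne'
    rw [abs_of_pos hq0] at hc
    refine ⟨_, ?_, hc⟩
    have h0 : projIcc (-1 : ℝ) 1 neg_one_le_one_real (0 / q.2) = ⟨0, by norm_num, by norm_num⟩ := by
      rw [zero_div]
      exact projIcc_of_mem _ (by norm_num)
    rw [h0, hq.2.1]
    exact (extChartAt (𝓡 n) x₀).left_inv hqs
  have hall : ∀ᶠ ε in 𝓝 (0 : ℝ), ∀ x ∈ (univ : Set M), 0 < ε →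
      ∃ γ : ℝ → M, γ 0 = x ∧ IsMIntegralCurveOn γ v (Ioo (-ε) ε) :=
    isCompact_univ.eventually_forall_of_forall_eventually fun x _ ↦
      (continuous_swap.tendsto ((0 : ℝ), x)).eventually (hloc x)
  obtain ⟨ε, hε, hε0⟩ := ((hall.filter_mono nhdsWithin_le_nhds).and
    (self_mem_nhdsWithin (s := Ioi (0 : ℝ)))).exists
  exact exists_isMIntegralCurve_of_isMIntegralCurveOn hv1 hε0 (fun x ↦ hε x (mem_univ x) hε0) x

/-- A smooth vector field on a closed manifold generates a smooth global flow. -/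
theorem exists_smooth_flow
    (hv : ContMDiff (𝓡 n) (𝓡 n).tangent ∞ (fun x ↦ (⟨x, v x⟩ : TangentBundle (𝓡 n) M))) :
    ∃ φ : Flow ℝ M, (∀ x, IsMIntegralCurve (φ · x) v) ∧
      ContMDiff (𝓘(ℝ, ℝ).prod (𝓡 n)) (𝓡 n) ∞ (fun p : ℝ × M ↦ φ p.1 p.2) := by
  have hv1 : ContMDiff (𝓡 n) (𝓡 n).tangent 1 (fun x ↦ (⟨x, v x⟩ : TangentBundle (𝓡 n) M)) :=
    hv.of_le (by simp)
  have : IsManifold (𝓡 n) 1 M := .of_le (n := ∞) (by simp)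
  choose γ hγ0 hγ using exists_isMIntegralCurve hv
  have hadd : ∀ s t x, γ x (s + t) = γ (γ x t) s := fun s t x ↦
    congrFun (isMIntegralCurve_Ioo_eq_of_contMDiff_boundaryless (t₀ := 0) hv1
      ((hγ x).comp_add t) (hγ (γ x t)) (by simp [hγ0])) s
  set Θ : ℝ × M → M := fun p ↦ γ p.2 p.1 with hΘ
  have hloc : ∀ x₀ : M, ContMDiffAt (𝓘(ℝ, ℝ).prod (𝓡 n)) (𝓡 n) ∞ Θ (0, x₀) := by
    intro x₀
    obtain ⟨U, hUs, hU⟩ := exists_local_integralCurves hv x₀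
    -- Time `t` is read off at parameter `1 / 2` of the solution with scale `2 * t`, so that `t` is
    -- interior to the interval on which this solution is an integral curve.
    let half : Icc (-1 : ℝ) 1 := ⟨1 / 2, by norm_num, by norm_num⟩
    let q : ℝ × M → EuclideanSpace ℝ (Fin n) × ℝ := fun p ↦ (extChartAt (𝓡 n) x₀ p.2, 2 * p.1)
    have hq0 : q (0, x₀) = (extChartAt (𝓡 n) x₀ x₀, 0) := by simp [q]
    have hq : ContMDiffAt (𝓘(ℝ, ℝ).prod (𝓡 n)) 𝓘(ℝ, EuclideanSpace ℝ (Fin n) × ℝ) ∞ q (0, x₀) :=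
      ((contMDiffAt_extChartAt (I := 𝓡 n) (n := ∞) (x := x₀)).comp (0, x₀)
        contMDiffAt_snd).prodMk_space (contMDiffAt_const.mul contMDiffAt_fst)
    have hqU : ∀ᶠ p in 𝓝 ((0 : ℝ), x₀), _ := hq.continuousAt.eventually (hq0 ▸ hU)
    have hsrc : ∀ᶠ p in 𝓝 ((0 : ℝ), x₀), p.2 ∈ (extChartAt (𝓡 n) x₀).source :=
      continuousAt_snd.eventually_mem (extChartAt_source_mem_nhds x₀)
    have hev : ∀ s : Icc (-1 : ℝ) 1, ContDiff ℝ ∞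
        (fun u : C(Icc (-1 : ℝ) 1, EuclideanSpace ℝ (Fin n)) ↦ u s) := fun s ↦
      (ContinuousMap.evalCLM (M := EuclideanSpace ℝ (Fin n)) ℝ s).contDiff
    have hUh : ContMDiffAt (𝓘(ℝ, ℝ).prod (𝓡 n)) 𝓘(ℝ, EuclideanSpace ℝ (Fin n)) ∞
        (fun p ↦ U (q p) half) (0, x₀) := by
      have h1 : ContDiffAt ℝ ∞ (fun p ↦ U p half) (q (0, x₀)) := by
        rw [hq0]
        exact (hev half).contDiffAt.comp _ hUs
      exact h1.contMDiffAt.comp (0, x₀) hq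
    have hmem : U (q (0, x₀)) half ∈ (extChartAt (𝓡 n) x₀).target := hqU.self_of_nhds.1 half
    have h2 : ContMDiffAt (𝓘(ℝ, ℝ).prod (𝓡 n)) (𝓡 n) ∞
        (fun p ↦ (extChartAt (𝓡 n) x₀).symm (U (q p) half)) (0, x₀) :=
      ((contMDiffOn_extChartAt_symm x₀).contMDiffAt
        ((isOpen_extChartAt_target x₀).mem_nhds hmem)).comp (0, x₀) hUh
    refine h2.congr_of_eventuallyEq ?_
    filter_upwards [hqU, hsrc] with p hp hps
    by_cases ht : p.1 = 0
    · rw [hp.2.2.1 (by simp [q, ht])]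
      simp only [hΘ, ht, hγ0, q]
      exact ((extChartAt (𝓡 n) x₀).left_inv hps).symm
    · have ht2 : 2 * p.1 ≠ 0 := mul_ne_zero two_ne_zero ht
      have habs : 0 < |2 * p.1| := abs_pos.2 ht2
      have hc := hp.2.2.2 ht2
      have heq := isMIntegralCurveOn_Ioo_eqOn_of_contMDiff_boundaryless (t₀ := 0)
        ⟨neg_lt_zero.2 habs, habs⟩ hv1 ((hγ p.2).isMIntegralCurveOn _) hc (by
          have h0 : projIcc (-1 : ℝ) 1 neg_one_le_one_real (0 / (q p).2)
              = ⟨0, by norm_num, by norm_num⟩ := by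
            rw [zero_div]
            exact projIcc_of_mem _ (by norm_num)
          rw [h0, hp.2.1, hγ0]
          exact ((extChartAt (𝓡 n) x₀).left_inv hps).symm)
      have h3 := heq (x := p.1) (by
        rw [mem_Ioo, ← abs_lt, abs_mul, abs_two]
        linarith [abs_pos.2 ht])
      have h4 : projIcc (-1 : ℝ) 1 neg_one_le_one_real (p.1 / (q p).2) = half := by
        have : p.1 / (q p).2 = 1 / 2 := by
          simp only [q]
          field_simp
        rw [this]
        exact projIcc_of_mem _ (by norm_num)
      simp only [h4] at h3
      exact h3
  have hsmooth : ContMDiff (𝓘(ℝ, ℝ).prod (𝓡 n)) (𝓡 n) ∞ Θ := by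
    -- Being `C^k` at a point spreads to a neighbourhood only for finite `k`. Compactness then gives
    -- `C^k` time maps for all small times, and iteration gives them for all times.
    refine contMDiff_infty.2 fun k ↦ ?_
    have hopen : ∀ x : M, ∀ᶠ p in 𝓝 ((0 : ℝ), x),
        ContMDiffAt (𝓘(ℝ, ℝ).prod (𝓡 n)) (𝓡 n) k Θ p := fun x ↦ by
      have : IsManifold (𝓡 n) k M := .of_le (n := ∞) (by exact_mod_cast le_top)
      exact (contMDiffAt_iff_contMDiffAt_nhds (by simp)).1
        ((hloc x).of_le (by exact_mod_cast le_top))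
    have hall : ∀ᶠ t in 𝓝 (0 : ℝ), ∀ x ∈ (univ : Set M),
        ContMDiffAt (𝓘(ℝ, ℝ).prod (𝓡 n)) (𝓡 n) k Θ (t, x) :=
      isCompact_univ.eventually_forall_of_forall_eventually fun x _ ↦ hopen x
    have hslice : ∀ᶠ t in 𝓝 (0 : ℝ), ContMDiff (𝓡 n) (𝓡 n) k (fun x ↦ Θ (t, x)) := by
      filter_upwards [hall] with t ht x
      exact (ht x (mem_univ x)).comp x (contMDiffAt_const.prodMk contMDiffAt_id)
    have hmul : ∀ t : ℝ, ContMDiff (𝓡 n) (𝓡 n) k (fun x ↦ Θ (t, x)) →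
        ∀ m : ℕ, ContMDiff (𝓡 n) (𝓡 n) k (fun x ↦ Θ (m * t, x)) := by
      intro t ht m
      induction m with
      | zero => exact contMDiff_id.congr fun x ↦ by simp [hΘ, hγ0]
      | succ m ih =>
        refine (ht.comp ih).congr fun x ↦ ?_
        simp only [hΘ, Function.comp_apply, ← hadd]
        congr 1
        push_cast
        ring
    have hslice_all : ∀ t : ℝ, ContMDiff (𝓡 n) (𝓡 n) k (fun x ↦ Θ (t, x)) := by
      intro t
      have htend : Tendsto (fun m : ℕ ↦ t / m) atTop (𝓝 0) :=
        tendsto_const_div_atTop_nhds_zero_nat t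
      obtain ⟨m, hm, hm0⟩ := ((htend.eventually hslice).and (eventually_gt_atTop 0)).exists
      have := hmul _ hm m
      rwa [mul_div_cancel₀ t (by positivity : (m : ℝ) ≠ 0)] at this
    rintro ⟨t₀, x₀⟩
    -- Near `(t₀, x₀)` use `Θ (t, x) = Θ (t₀, Θ (t - t₀, x))`.
    have h1 : ContMDiffAt (𝓘(ℝ, ℝ).prod (𝓡 n)) (𝓡 n) k Θ (t₀ - t₀, x₀) := by
      rw [sub_self]
      exact (hloc x₀).of_le (by exact_mod_cast le_top)
    have h2 : ContMDiffAt (𝓘(ℝ, ℝ).prod (𝓡 n)) (𝓘(ℝ, ℝ).prod (𝓡 n)) k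
        (fun p : ℝ × M ↦ (p.1 - t₀, p.2)) (t₀, x₀) :=
      (contMDiffAt_fst.sub contMDiffAt_const).prodMk contMDiffAt_snd
    refine ((hslice_all t₀).contMDiffAt.comp (t₀, x₀) (h1.comp (t₀, x₀) h2)).congr_of_eventuallyEq
      (Eventually.of_forall fun p ↦ ?_)
    simp only [hΘ, Function.comp_apply, ← hadd]
    congr 1
    ring
  refine ⟨⟨fun t x ↦ γ x t, hsmooth.continuous, fun s t x ↦ hadd s t x, hγ0⟩, hγ, hsmooth⟩

end GlobalFlow

/-! ### Scalar products with a prescribed gradient vector -/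

section BilinearForms

variable {E : Type*} [NormedAddCommGroup E] [InnerProductSpace ℝ E]

theorem isVonNBounded_of_posDef [FiniteDimensional ℝ E] (B : E →L[ℝ] E →L[ℝ] ℝ)
    (hB : ∀ a, a ≠ 0 → 0 < B a a) : Bornology.IsVonNBounded ℝ {a : E | B a a < 1} := by
  have hcont : Continuous fun a ↦ B a a := by fun_prop
  have hc : ∃ c > 0, ∀ u ∈ Metric.sphere (0 : E) 1, c ≤ B u u := by
    rcases (Metric.sphere (0 : E) 1).eq_empty_or_nonempty with h | h
    · exact ⟨1, one_pos, by simp [h]⟩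
    · obtain ⟨u, hu, hmin⟩ := (isCompact_sphere (0 : E) 1).exists_isMinOn h hcont.continuousOn
      exact ⟨B u u, hB u (ne_zero_of_mem_unit_sphere ⟨u, hu⟩), fun w hw ↦ hmin hw⟩
  obtain ⟨c, hc, hcB⟩ := hc
  rw [NormedSpace.isVonNBounded_iff, isBounded_iff_forall_norm_le]
  refine ⟨√(1 / c), fun a ha ↦ Real.le_sqrt_of_sq_le ?_⟩
  by_cases h0 : a = 0
  · subst h0
    simp [hc.le]
  have hn : 0 < ‖a‖ := norm_pos_iff.2 h0
  have h1 := hcB (‖a‖⁻¹ • a) (by simp [norm_smul, hn.ne'])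
  simp only [map_smul, smul_apply, smul_eq_mul] at h1
  have ha' : B a a < 1 := ha
  rw [le_div_iff₀ hc]
  have h2 : ‖a‖ ^ 2 * c ≤ ‖a‖ ^ 2 * (‖a‖⁻¹ * (‖a‖⁻¹ * B a a)) := by gcongr
  have h3 : ‖a‖ ^ 2 * (‖a‖⁻¹ * (‖a‖⁻¹ * B a a)) = B a a := by field_simp
  linarith

/-- The projection onto the kernel of `l` along `w`. -/
def kernelProj (w : E) (l : E →L[ℝ] ℝ) : E →L[ℝ] E :=
  ContinuousLinearMap.id ℝ E - (l w)⁻¹ • l.smulRight w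

theorem kernelProj_apply (w : E) (l : E →L[ℝ] ℝ) (a : E) :
    kernelProj w l a = a - ((l w)⁻¹ * l a) • w := by
  simp [kernelProj, smul_smul]

/-- A scalar product for which the vector `w` represents the functional `l`, if `0 < l w`. -/
def gradientForm (w : E) (l : E →L[ℝ] ℝ) : E →L[ℝ] E →L[ℝ] ℝ :=
  ((kernelProj w l).precomp ℝ).comp ((show E →L[ℝ] E →L[ℝ] ℝ from innerSL ℝ).comp
    (kernelProj w l)) +
    (l w)⁻¹ • l.smulRight l

theorem gradientForm_apply (w : E) (l : E →L[ℝ] ℝ) (a b : E) :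
    gradientForm w l a b = inner ℝ (a - ((l w)⁻¹ * l a) • w) (b - ((l w)⁻¹ * l b) • w)
      + (l w)⁻¹ * (l a * l b) := by
  rw [← kernelProj_apply, ← kernelProj_apply]
  rfl

theorem gradientForm_symm (w : E) (l : E →L[ℝ] ℝ) (a b : E) :
    gradientForm w l a b = gradientForm w l b a := by
  rw [gradientForm_apply, gradientForm_apply, real_inner_comm, mul_comm (l a)]

theorem gradientForm_pos {w : E} {l : E →L[ℝ] ℝ} (h : 0 < l w) {a : E} (ha : a ≠ 0) :
    0 < gradientForm w l a a := by
  rw [gradientForm_apply, real_inner_self_eq_norm_sq]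
  by_cases hla : l a = 0
  · have : 0 < ‖a‖ := norm_pos_iff.2 ha
    simp only [hla, mul_zero, zero_smul, sub_zero, add_zero]
    positivity
  · have : 0 < l a * l a := mul_self_pos.2 hla
    positivity

theorem gradientForm_self_left {w : E} {l : E →L[ℝ] ℝ} (h : 0 < l w) (b : E) :
    gradientForm w l w b = l b := by
  rw [gradientForm_apply, inv_mul_cancel₀ h.ne', one_smul, sub_self, inner_zero_left, zero_add,
    ← mul_assoc, inv_mul_cancel₀ h.ne', one_mul]

theorem contDiffOn_gradientForm [FiniteDimensional ℝ E] {s : Set E} {w : E → E}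
    {l : E → E →L[ℝ] ℝ} (hw : ContDiffOn ℝ ∞ w s) (hl : ContDiffOn ℝ ∞ l s)
    (h : ∀ y ∈ s, 0 < l y (w y)) : ContDiffOn ℝ ∞ (fun y ↦ gradientForm (w y) (l y)) s := by
  rw [contDiffOn_clm_apply]
  intro a
  rw [contDiffOn_clm_apply]
  intro b
  simp only [gradientForm_apply]
  have hlc : ∀ c : E, ContDiffOn ℝ ∞ (fun y ↦ l y c) s := fun c ↦ hl.clm_apply contDiffOn_const
  have hinv : ContDiffOn ℝ ∞ (fun y ↦ (l y (w y))⁻¹) s :=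
    (hl.clm_apply hw).inv fun y hy ↦ (h y hy).ne'
  exact (((contDiffOn_const.sub ((hinv.mul (hlc a)).smul hw)).inner ℝ
    (contDiffOn_const.sub ((hinv.mul (hlc b)).smul hw)))).add (hinv.mul ((hlc a).mul (hlc b)))

end BilinearForms

/-! ### Smooth fields of bilinear forms given in a chart -/

section Metric

variable {n : ℕ} {M : Type*} [TopologicalSpace M] [ChartedSpace (EuclideanSpace ℝ (Fin n)) M]
  [IsManifold (𝓡 n) ∞ M]

/-- The field of bilinear forms that is given by `β` in the chart at `x₀`. -/
def pullbackForm (x₀ : M)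
    (β : EuclideanSpace ℝ (Fin n) → EuclideanSpace ℝ (Fin n) →L[ℝ] EuclideanSpace ℝ (Fin n) →L[ℝ] ℝ)
    (x : M) : TangentSpace (𝓡 n) x →L[ℝ] TangentSpace (𝓡 n) x →L[ℝ] ℝ :=
  let D : TangentSpace (𝓡 n) x →L[ℝ] EuclideanSpace ℝ (Fin n) :=
    mfderiv (𝓡 n) 𝓘(ℝ, EuclideanSpace ℝ (Fin n)) (extChartAt (𝓡 n) x₀) x
  (D.precomp ℝ).comp ((β (extChartAt (𝓡 n) x₀ x)).comp D)

set_option synthInstance.maxHeartbeats 400000 in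
theorem contMDiffOn_pullbackForm (x₀ : M) {s : Set (EuclideanSpace ℝ (Fin n))}
    {β : EuclideanSpace ℝ (Fin n) → EuclideanSpace ℝ (Fin n) →L[ℝ] EuclideanSpace ℝ (Fin n) →L[ℝ] ℝ}
    (hβ : ContDiffOn ℝ ∞ β s) :
    ContMDiffOn (𝓡 n)
      ((𝓡 n).prod 𝓘(ℝ, EuclideanSpace ℝ (Fin n) →L[ℝ] EuclideanSpace ℝ (Fin n) →L[ℝ] ℝ)) ∞
      (fun x ↦ TotalSpace.mk' (EuclideanSpace ℝ (Fin n) →L[ℝ] EuclideanSpace ℝ (Fin n) →L[ℝ] ℝ)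
        (E := fun x : M ↦ TangentSpace (𝓡 n) x →L[ℝ] TangentSpace (𝓡 n) x →L[ℝ] ℝ) x
        (pullbackForm x₀ β x)) ((extChartAt (𝓡 n) x₀).source ∩ extChartAt (𝓡 n) x₀ ⁻¹' s) := by
  set e := trivializationAt (EuclideanSpace ℝ (Fin n) →L[ℝ] EuclideanSpace ℝ (Fin n) →L[ℝ] ℝ)
    (fun x : M ↦ TangentSpace (𝓡 n) x →L[ℝ] TangentSpace (𝓡 n) x →L[ℝ] ℝ) x₀ with he
  have hsub : ∀ x ∈ (extChartAt (𝓡 n) x₀).source, x ∈ e.baseSet := by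
    intro x hx
    simpa [he] using hx
  refine (e.contMDiffOn_iff (fun x hx ↦ e.mem_source.2 (hsub x hx.1))).2 ⟨contMDiffOn_id, ?_⟩
  have h1 : ContMDiffOn (𝓡 n)
      𝓘(ℝ, EuclideanSpace ℝ (Fin n) →L[ℝ] EuclideanSpace ℝ (Fin n) →L[ℝ] ℝ) ∞
      (fun x ↦ β (extChartAt (𝓡 n) x₀ x))
      ((extChartAt (𝓡 n) x₀).source ∩ extChartAt (𝓡 n) x₀ ⁻¹' s) :=
    hβ.contMDiffOn.comp ((contMDiffOn_extChartAt (x := x₀)).mono (by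
      rw [← extChartAt_source (𝓡 n)]
      exact inter_subset_left)) (fun x hx ↦ hx.2)
  refine h1.congr fun x hx ↦ ?_
  have hx' : x ∈ (chartAt (EuclideanSpace ℝ (Fin n)) x₀).source := by simpa using hx.1
  rw [he, hom_trivializationAt_apply]
  ext a b
  refine (inCoordinates_apply_eq₂ (by simpa using hx') (by simpa using hx') (by simp)).trans ?_
  have hD : ∀ c : EuclideanSpace ℝ (Fin n),
      mfderiv (𝓡 n) 𝓘(ℝ, EuclideanSpace ℝ (Fin n)) (extChartAt (𝓡 n) x₀) x
        ((trivializationAt (EuclideanSpace ℝ (Fin n)) (TangentSpace (𝓡 n)) x₀).symm x c) = c := by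
    intro c
    have h3 := DFunLike.congr_fun (TangentBundle.continuousLinearMapAt_trivializationAt
      (I := 𝓡 n) hx')
      ((trivializationAt (EuclideanSpace ℝ (Fin n)) (TangentSpace (𝓡 n)) x₀).symm x c)
    refine h3.symm.trans ?_
    have h5 := Trivialization.continuousLinearMapAt_symmL (R := ℝ)
      (trivializationAt (EuclideanSpace ℝ (Fin n)) (TangentSpace (𝓡 n)) x₀)
      (b := x) (by simpa using hx') c
    rwa [Trivialization.symmL_apply _ (by simpa using hx')] at h5
  have h4 := congrArg₂ (fun a b ↦ β (extChartAt (𝓡 n) x₀ x) a b) (hD a) (hD b)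
  simp
  exact h4

end Metric

/-! ### Existence of a metric for a given potential -/

section MetricExistence

variable {n : ℕ} {M : Type*} [TopologicalSpace M] [ChartedSpace (EuclideanSpace ℝ (Fin n)) M]
  {v : (x : M) → TangentSpace (𝓡 n) x} {f : M → ℝ}

/-- The derivative of the function `f` along the vector field `v`. -/
def lieDeriv (v : (x : M) → TangentSpace (𝓡 n) x) (f : M → ℝ) (x : M) : ℝ :=
  mfderiv (𝓡 n) 𝓘(ℝ, ℝ) f x (v x)

theorem chartField_extChartAt {x₀ x : M} (hx : x ∈ (extChartAt (𝓡 n) x₀).source) :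
    chartField v x₀ (extChartAt (𝓡 n) x₀ x) =
      mfderiv (𝓡 n) 𝓘(ℝ, EuclideanSpace ℝ (Fin n)) (extChartAt (𝓡 n) x₀) x (v x) := by
  unfold chartField
  rw [(extChartAt (𝓡 n) x₀).left_inv hx]

theorem pullbackForm_apply (x₀ : M)
    (β : EuclideanSpace ℝ (Fin n) → EuclideanSpace ℝ (Fin n) →L[ℝ] EuclideanSpace ℝ (Fin n) →L[ℝ] ℝ)
    (x : M) (a b : TangentSpace (𝓡 n) x) :
    pullbackForm x₀ β x a b = β (extChartAt (𝓡 n) x₀ x)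
      (mfderiv (𝓡 n) 𝓘(ℝ, EuclideanSpace ℝ (Fin n)) (extChartAt (𝓡 n) x₀) x a)
      (mfderiv (𝓡 n) 𝓘(ℝ, EuclideanSpace ℝ (Fin n)) (extChartAt (𝓡 n) x₀) x b) := rfl

variable [IsManifold (𝓡 n) ∞ M]

theorem contDiffOn_comp_extChartAt_symm (hf : ContMDiff (𝓡 n) 𝓘(ℝ, ℝ) ∞ f) (x₀ : M) :
    ContDiffOn ℝ ∞ (f ∘ (extChartAt (𝓡 n) x₀).symm) (extChartAt (𝓡 n) x₀).target :=
  (hf.comp_contMDiffOn (contMDiffOn_extChartAt_symm x₀)).contDiffOn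

theorem fderiv_comp_extChartAt_symm_apply (hf : ContMDiff (𝓡 n) 𝓘(ℝ, ℝ) ∞ f) {x₀ x : M}
    (hx : x ∈ (extChartAt (𝓡 n) x₀).source) (a : TangentSpace (𝓡 n) x) :
    fderiv ℝ (f ∘ (extChartAt (𝓡 n) x₀).symm) (extChartAt (𝓡 n) x₀ x)
      (mfderiv (𝓡 n) 𝓘(ℝ, EuclideanSpace ℝ (Fin n)) (extChartAt (𝓡 n) x₀) x a) =
      mfderiv (𝓡 n) 𝓘(ℝ, ℝ) f x a := by
  have h1 : HasMFDerivAt (𝓡 n) 𝓘(ℝ, EuclideanSpace ℝ (Fin n)) (extChartAt (𝓡 n) x₀) x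
      (mfderiv (𝓡 n) 𝓘(ℝ, EuclideanSpace ℝ (Fin n)) (extChartAt (𝓡 n) x₀) x) :=
    (mdifferentiableAt_extChartAt (by simpa using hx)).hasMFDerivAt
  have h2 : DifferentiableAt ℝ (f ∘ (extChartAt (𝓡 n) x₀).symm) (extChartAt (𝓡 n) x₀ x) :=
    ((contDiffOn_comp_extChartAt_symm hf x₀).contDiffAt
      ((isOpen_extChartAt_target x₀).mem_nhds
        ((extChartAt (𝓡 n) x₀).map_source hx))).differentiableAt (by simp)
  have h3 := h2.hasFDerivAt.hasMFDerivAt.comp x h1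
  have h4 : f =ᶠ[𝓝 x] (f ∘ (extChartAt (𝓡 n) x₀).symm) ∘ extChartAt (𝓡 n) x₀ := by
    filter_upwards [(isOpen_extChartAt_source x₀).mem_nhds hx] with y hy
    simp only [Function.comp_apply]
    rw [(extChartAt (𝓡 n) x₀).left_inv hy]
  exact (DFunLike.congr_fun (h3.congr_of_eventuallyEq h4).mfderiv a).symm

theorem mfderiv_extChartAt_apply_ne_zero {x₀ x : M} (hx : x ∈ (extChartAt (𝓡 n) x₀).source)
    {a : TangentSpace (𝓡 n) x} (ha : a ≠ 0) :
    mfderiv (𝓡 n) 𝓘(ℝ, EuclideanSpace ℝ (Fin n)) (extChartAt (𝓡 n) x₀) x a ≠ 0 := by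
  intro h0
  have h1 := DFunLike.congr_fun
    (mfderivWithin_extChartAt_symm_comp_mfderiv_extChartAt' (I := 𝓡 n) hx) a
  rw [ContinuousLinearMap.comp_apply, h0, map_zero] at h1
  exact ha h1.symm

set_option synthInstance.maxHeartbeats 400000 in
theorem exists_pullbackForm_of_lieDeriv_pos
    (hv : ContMDiff (𝓡 n) (𝓡 n).tangent ∞ (fun x ↦ (⟨x, v x⟩ : TangentBundle (𝓡 n) M)))
    (hf : ContMDiff (𝓡 n) 𝓘(ℝ, ℝ) ∞ f) {x₀ : M} (h0 : 0 < lieDeriv v f x₀) :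
    ∃ U ∈ 𝓝 x₀, ∃ s : ∀ x : M, TangentSpace (𝓡 n) x →L[ℝ] TangentSpace (𝓡 n) x →L[ℝ] ℝ,
      ContMDiffOn (𝓡 n)
        ((𝓡 n).prod 𝓘(ℝ, EuclideanSpace ℝ (Fin n) →L[ℝ] EuclideanSpace ℝ (Fin n) →L[ℝ] ℝ)) ∞
        (fun x ↦ TotalSpace.mk' (EuclideanSpace ℝ (Fin n) →L[ℝ] EuclideanSpace ℝ (Fin n) →L[ℝ] ℝ)
          (E := fun x : M ↦ TangentSpace (𝓡 n) x →L[ℝ] TangentSpace (𝓡 n) x →L[ℝ] ℝ) x (s x)) U ∧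
      ∀ y ∈ U, (∀ a b, s y a b = s y b a) ∧ (∀ a, a ≠ 0 → 0 < s y a a) ∧
        IsGradientAt f y (s y) (v y) := by
  set e := extChartAt (𝓡 n) x₀ with he
  let w := chartField v x₀
  let l := fderiv ℝ (f ∘ e.symm)
  have hw : ContDiffOn ℝ ∞ w e.target := contDiffOn_chartField hv x₀
  have hl : ContDiffOn ℝ ∞ l e.target :=
    (contDiffOn_comp_extChartAt_symm hf x₀).fderiv_of_isOpen (isOpen_extChartAt_target x₀)
      (by simp)
  have hlw : ∀ x ∈ e.source, l (e x) (w (e x)) = lieDeriv v f x := fun x hx ↦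
    (congrArg (l (e x)) (chartField_extChartAt hx)).trans
      (fderiv_comp_extChartAt_symm_apply hf hx (v x))
  let s := e.target ∩ (fun z ↦ l z (w z)) ⁻¹' Ioi 0
  have hs : IsOpen s := (hl.clm_apply hw).continuousOn.isOpen_inter_preimage
    (isOpen_extChartAt_target x₀) isOpen_Ioi
  have hβ : ContDiffOn ℝ ∞ (fun z ↦ gradientForm (w z) (l z)) s :=
    contDiffOn_gradientForm (hw.mono inter_subset_left) (hl.mono inter_subset_left)
      fun z hz ↦ hz.2
  have hx₀ : x₀ ∈ e.source := mem_extChartAt_source x₀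
  refine ⟨e.source ∩ e ⁻¹' s, ?_, pullbackForm x₀ (fun z ↦ gradientForm (w z) (l z)),
    contMDiffOn_pullbackForm x₀ hβ, fun y hy ↦ ⟨fun a b ↦ ?_, fun a ha ↦ ?_, fun a ↦ ?_⟩⟩
  · refine ((continuousOn_extChartAt x₀).isOpen_inter_preimage (isOpen_extChartAt_source x₀)
      hs).mem_nhds ⟨hx₀, e.map_source hx₀, ?_⟩
    exact h0.trans_eq (hlw x₀ hx₀).symm
  · exact gradientForm_symm (w (e y)) (l (e y)) _ _
  · exact gradientForm_pos (w := w (e y)) (l := l (e y)) hy.2.2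
      (mfderiv_extChartAt_apply_ne_zero hy.1 ha)
  · refine (pullbackForm_apply x₀ _ y _ _).trans (Eq.trans ?_
      ((gradientForm_self_left (w := w (e y)) (l := l (e y)) hy.2.2 _).trans
      (fderiv_comp_extChartAt_symm_apply hf hy.1 a)))
    exact congrArg (fun c ↦ gradientForm (w (e y)) (l (e y)) c
      (mfderiv (𝓡 n) 𝓘(ℝ, EuclideanSpace ℝ (Fin n)) e y a)) (chartField_extChartAt hy.1).symm

set_option maxHeartbeats 2000000 in
set_option synthInstance.maxHeartbeats 400000 in
/-- A function that increases along a vector field, and has it as a gradient near the points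
where it does not increase strictly, has it as a gradient for some Riemannian metric. -/
theorem exists_riemannianMetric_isGradientAt [T2Space M] [SigmaCompactSpace M]
    (hv : ContMDiff (𝓡 n) (𝓡 n).tangent ∞ (fun x ↦ (⟨x, v x⟩ : TangentBundle (𝓡 n) M)))
    (hf : ContMDiff (𝓡 n) 𝓘(ℝ, ℝ) ∞ f)
    (h : ∀ x, 0 < lieDeriv v f x ∨ ∃ U : Set M, IsOpen U ∧ x ∈ U ∧
      ∃ ρ : SmoothMetricOn (n := n) U, ∀ y ∈ U, IsGradientAt f y (ρ.inner y) (v y)) :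
    ∃ ρ : ContMDiffRiemannianMetric (𝓡 n) ∞ (EuclideanSpace ℝ (Fin n))
        (fun x : M ↦ TangentSpace (𝓡 n) x), ∀ x, IsGradientAt f x (ρ.inner x) (v x) := by
  -- For fixed `f` and `v` the gradient condition is affine in the form, so all three requirements
  -- survive convex combinations.
  let t : ∀ x : M, Set (TangentSpace (𝓡 n) x →L[ℝ] TangentSpace (𝓡 n) x →L[ℝ] ℝ) := fun x ↦
    {B | (∀ a b, B a b = B b a) ∧ (∀ a, a ≠ 0 → 0 < B a a) ∧ IsGradientAt f x B (v x)}
  have ht : ∀ x, Convex ℝ (t x) := by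
    rintro x B ⟨hB1, hB2, hB3⟩ C ⟨hC1, hC2, hC3⟩ p q hp hq hpq
    refine ⟨fun a b ↦ ?_, fun a ha ↦ ?_, fun a ↦ ?_⟩
    · change p * B a b + q * C a b = p * B b a + q * C b a
      rw [hB1, hC1]
    · change 0 < p * B a a + q * C a a
      have h1 := hB2 a ha
      have h2 := hC2 a ha
      rcases hp.eq_or_lt with rfl | hp'
      · have : q = 1 := by linarith
        subst this
        linarith
      · have := mul_pos hp' h1
        have := mul_nonneg hq h2.le
        linarith
    · have h1 : p * B (v x) a + q * C (v x) a = B (v x) a := by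
        rw [hC3 a, ← hB3 a, ← add_mul, hpq, one_mul]
      exact h1.trans (hB3 a)
  obtain ⟨s, hs⟩ := exists_contMDiffSection_forall_mem_convex_of_local (n := (⊤ : ℕ∞)) (𝓡 n)
    (F_fiber := EuclideanSpace ℝ (Fin n) →L[ℝ] EuclideanSpace ℝ (Fin n) →L[ℝ] ℝ)
    (fun x : M ↦ TangentSpace (𝓡 n) x →L[ℝ] TangentSpace (𝓡 n) x →L[ℝ] ℝ) t ht (by
      intro x₀
      rcases h x₀ with h0 | ⟨U, hU, hxU, ρ, hρ⟩
      · exact exists_pullbackForm_of_lieDeriv_pos hv hf h0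
      · exact ⟨U, hU.mem_nhds hxU, ρ.inner, ρ.contMDiffOn, fun y hy ↦
          ⟨ρ.symm y hy, ρ.pos y hy, hρ y hy⟩⟩)
  exact ⟨⟨fun x ↦ s x, fun x ↦ (hs x).1, fun x ↦ (hs x).2.1, fun x ↦
    isVonNBounded_of_posDef (E := EuclideanSpace ℝ (Fin n)) (s x) (hs x).2.1, s.contMDiff⟩,
    fun x ↦ (hs x).2.2⟩

end MetricExistence

/-! ### Functions that do not decrease along the flow -/

section Lyapunov

variable {n : ℕ} {M : Type*} [TopologicalSpace M]
  [ChartedSpace (EuclideanSpace ℝ (Fin n)) M]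
  {v : (x : M) → TangentSpace (𝓡 n) x} {φ : Flow ℝ M}

/-- The integral of the function `F` along the trajectories of a flow during the time `T`. -/
def flowIntegral (φ : Flow ℝ M) (T : ℝ) (F : M → ℝ) (x : M) : ℝ :=
  ∫ s in (0 : ℝ)..T, F (φ s x)

theorem hasDerivAt_comp_of_isMIntegralCurve {γ : ℝ → M} (hγ : IsMIntegralCurve γ v) {f : M → ℝ}
    {t : ℝ} (hf : MDifferentiableAt (𝓡 n) 𝓘(ℝ, ℝ) f (γ t)) :
    HasDerivAt (f ∘ γ) (lieDeriv v f (γ t)) t := by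
  have h1 : HasFDerivAt (f ∘ γ) (_ : ℝ →L[ℝ] ℝ) t :=
    (hf.hasMFDerivAt.comp t (hγ t)).hasFDerivAt
  refine h1.hasDerivAt.congr_deriv ?_
  exact congrArg (mfderiv (𝓡 n) 𝓘(ℝ, ℝ) f (γ t)) (one_smul ℝ (v (γ t)))

theorem hasDerivAt_flowIntegral (T : ℝ) {F : M → ℝ} (hF : Continuous F) (x : M) :
    HasDerivAt (fun t ↦ flowIntegral φ T F (φ t x)) (F (φ T x) - F x) 0 := by
  let u : ℝ → ℝ := fun s ↦ F (φ s x)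
  have hu : Continuous u := hF.comp (φ.cont'.comp (continuous_id.prodMk continuous_const))
  have h1 : ∀ t, flowIntegral φ T F (φ t x) =
      -- Moving the starting point along its orbit shifts the window of integration.
      (∫ s in (0 : ℝ)..(t + T), u s) - ∫ s in (0 : ℝ)..t, u s := by
    intro t
    rw [intervalIntegral.integral_interval_sub_left (hu.intervalIntegrable _ _)
      (hu.intervalIntegrable _ _)]
    have h2 := intervalIntegral.integral_comp_add_right (a := 0) (b := T) u t
    rw [zero_add, add_comm T] at h2
    rw [← h2]
    refine intervalIntegral.integral_congr fun s _ ↦ ?_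
    simp [u, Flow.map_add]
  have h2 : ∀ a, HasDerivAt (fun t ↦ ∫ s in (0 : ℝ)..t, u s) (u a) a := fun a ↦
    intervalIntegral.integral_hasDerivAt_right (hu.intervalIntegrable _ _)
      hu.aestronglyMeasurable.stronglyMeasurableAtFilter hu.continuousAt
  have h3 : HasDerivAt (fun t ↦ ∫ s in (0 : ℝ)..(t + T), u s) (u (0 + T)) 0 :=
    (h2 (0 + T)).comp_add_const 0 T
  have h4 := h3.sub (h2 0)
  simp only [zero_add, u, Flow.map_zero_apply] at h4
  exact h4.congr_of_eventuallyEq (.of_forall h1)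

theorem mfderiv_eq_zero_of_eventually_eq {F : M → ℝ} {c : ℝ} {x : M} (h : ∀ᶠ y in 𝓝 x, F y = c) :
    ∀ᶠ y in 𝓝 x, mfderiv (𝓡 n) 𝓘(ℝ, ℝ) F y = 0 := by
  filter_upwards [h.eventually_nhds] with y hy
  have : F =ᶠ[𝓝 y] fun _ ↦ c := hy
  rw [this.mfderiv_eq]
  exact mfderiv_const

variable [IsManifold (𝓡 n) ∞ M]

theorem contMDiff_flowIntegral
    (hφ : ContMDiff (𝓘(ℝ, ℝ).prod (𝓡 n)) (𝓡 n) ∞ (fun p : ℝ × M ↦ φ p.1 p.2)) {T : ℝ}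
    (hT : 0 ≤ T) {F : M → ℝ} (hF : ContMDiff (𝓡 n) 𝓘(ℝ, ℝ) ∞ F) :
    ContMDiff (𝓡 n) 𝓘(ℝ, ℝ) ∞ (flowIntegral φ T F) := by
  intro x₀
  set e := extChartAt (𝓡 n) x₀
  let Φ : EuclideanSpace ℝ (Fin n) × ℝ → ℝ := fun p ↦ F (φ p.2 (e.symm p.1))
  have hΦ : ContDiffOn ℝ ∞ Φ (e.target ×ˢ univ) := by
    rw [← contMDiffOn_iff_contDiffOn]
    have h1 : ContMDiffOn 𝓘(ℝ, EuclideanSpace ℝ (Fin n) × ℝ) (𝓘(ℝ, ℝ).prod (𝓡 n)) ∞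
        (fun p : EuclideanSpace ℝ (Fin n) × ℝ ↦ (p.2, e.symm p.1)) (e.target ×ˢ univ) :=
      ContMDiffOn.prodMk (contMDiffOn_iff_contDiffOn.2 contDiff_snd.contDiffOn)
        ((contMDiffOn_extChartAt_symm x₀).comp
          (contMDiffOn_iff_contDiffOn.2 contDiff_fst.contDiffOn) fun p hp ↦ hp.1)
    exact (hF.comp hφ).comp_contMDiffOn h1
  obtain ⟨R, hR, hRs⟩ := Metric.nhds_basis_closedBall.mem_iff.1
    (extChartAt_target_mem_nhds (I := 𝓡 n) x₀)
  -- The cut-off acts on the space variable only, so the integral is unchanged near `x₀`.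
  let χ : ContDiffBump (e x₀) := ⟨R / 2, R, by positivity, by linarith⟩
  have hg : ContDiff ℝ ∞ fun p : EuclideanSpace ℝ (Fin n) × ℝ ↦ χ p.1 * Φ p := by
    refine contDiff_iff_contDiffAt.2 fun p ↦ ?_
    by_cases hpR : p.1 ∈ Metric.closedBall (e x₀) R
    · refine ContDiffAt.mul (χ.contDiff.contDiffAt.comp p contDiffAt_fst) (hΦ.contDiffAt
        (((isOpen_extChartAt_target x₀).prod isOpen_univ).mem_nhds ⟨hRs hpR, mem_univ _⟩))
    · refine (contDiffAt_const (c := (0 : ℝ))).congr_of_eventuallyEq ?_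
      filter_upwards [continuous_fst.continuousAt.eventually_mem
        (Metric.isClosed_closedBall.isOpen_compl.mem_nhds hpR)] with q hq
      have : χ q.1 = 0 := χ.zero_of_le_dist (by
        have : q.1 ∉ Metric.closedBall (e x₀) R := hq
        rw [Metric.mem_closedBall, not_le] at this
        exact this.le)
      rw [this, zero_mul]
  have h1 := (contDiff_intervalIntegral hT hg).contMDiff.contMDiffAt.comp x₀
    (contMDiffAt_extChartAt (I := 𝓡 n) (n := ∞) (x := x₀))
  refine h1.congr_of_eventuallyEq ?_
  filter_upwards [extChartAt_source_mem_nhds (I := 𝓡 n) x₀,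
    (continuousAt_extChartAt (I := 𝓡 n) x₀).eventually_mem
      (Metric.closedBall_mem_nhds _ (half_pos hR))] with x hx hxR
  refine intervalIntegral.integral_congr fun s _ ↦ ?_
  have : χ (e x) = 1 := χ.one_of_mem_closedBall hxR
  simp only [Φ]
  rw [this, one_mul, e.left_inv hx]

theorem lieDeriv_flowIntegral (hv : ∀ x, IsMIntegralCurve (φ · x) v)
    (hφ : ContMDiff (𝓘(ℝ, ℝ).prod (𝓡 n)) (𝓡 n) ∞ (fun p : ℝ × M ↦ φ p.1 p.2)) {T : ℝ}
    (hT : 0 ≤ T) {F : M → ℝ} (hF : ContMDiff (𝓡 n) 𝓘(ℝ, ℝ) ∞ F) (x : M) :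
    lieDeriv v (flowIntegral φ T F) x = F (φ T x) - F x := by
  have h1 := hasDerivAt_comp_of_isMIntegralCurve (hv x) (t := 0)
    ((contMDiff_flowIntegral hφ hT hF).mdifferentiable (by simp) _)
  rw [Flow.map_zero_apply] at h1
  exact h1.unique (hasDerivAt_flowIntegral T hF.continuous x)

theorem eventually_flowIntegral_eq {T c : ℝ} {F : M → ℝ} {x : M} (hx : ∀ t, φ t x = x)
    (hF : ∀ᶠ y in 𝓝 x, F y = c) : ∀ᶠ y in 𝓝 x, flowIntegral φ T F y = T * c := by
  have h1 : ∀ᶠ y in 𝓝 x, ∀ t ∈ uIcc 0 T, F (φ t y) = c := by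
    refine isCompact_uIcc.eventually_forall_of_forall_eventually fun t _ ↦ ?_
    have h2 : Tendsto (fun p : M × ℝ ↦ φ p.2 p.1) (𝓝 (x, t)) (𝓝 (φ t x)) :=
      (φ.cont'.comp continuous_swap).tendsto (x, t)
    rw [hx] at h2
    exact h2.eventually hF
  filter_upwards [h1] with y hy
  rw [flowIntegral, intervalIntegral.integral_congr hy]
  simp

variable [T2Space M] [CompactSpace M]

/-- For every moving point there is a function that does not decrease along the flow, increases
at this point, and is constant near each singular point. -/
theorem IsRankedFlow.exists_monotone_function {S : Set M} {r : M → ℕ} (h : IsRankedFlow φ S r)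
    (hv : ∀ x, IsMIntegralCurve (φ · x) v)
    (hφ : ContMDiff (𝓘(ℝ, ℝ).prod (𝓡 n)) (𝓡 n) ∞ (fun p : ℝ × M ↦ φ p.1 p.2)) {p : M}
    (hp : p ∉ S) :
    ∃ G : M → ℝ, ContMDiff (𝓡 n) 𝓘(ℝ, ℝ) ∞ G ∧ (∀ x, 0 ≤ lieDeriv v G x) ∧ 0 < lieDeriv v G p ∧
      ∀ s ∈ S, ∀ᶠ y in 𝓝 s, mfderiv (𝓡 n) 𝓘(ℝ, ℝ) G y = 0 := by
  obtain ⟨a, ha, hpa⟩ := h.alpha p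
  obtain ⟨b, hb, hpb⟩ := h.omega p
  have hab := h.rank_lt p hp a ha b hb hpa hpb
  have hpU : p ∉ upperSet φ S r (r b) := by
    rintro ⟨a', ha', hpa', hr⟩
    rw [tendsto_nhds_unique hpa hpa'] at hab
    omega
  have hbU : b ∈ upperSet φ S r (r b) := ⟨b, hb, by simp [h.fixed b hb], le_rfl⟩
  -- The threshold is the rank of the end `b` of the orbit of `p`. Thus `p` starts below it and may
  -- be added to the zero set, while its orbit runs into the region where `F = 1`.
  obtain ⟨F, hF0, hF1, hF⟩ := exists_contMDiffMap_zero_one_nhds_of_isClosed (𝓡 n) (n := ⊤)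
    ((h.isClosed_lowerSet (r b)).union (isClosed_singleton (x := p))) (h.isClosed_upperSet (r b))
    (disjoint_union_left.2 ⟨h.disjoint_lowerSet_upperSet _, disjoint_singleton_left.2 hpU⟩)
  rw [eventually_nhdsSet_iff_forall] at hF0 hF1
  obtain ⟨T₀, hT₀⟩ := h.exists_forall_le_map hF hF1 fun x hx ↦ hF0 x (Or.inl hx)
  obtain ⟨T, hTF, hT, hT0⟩ := ((hpb.eventually (hF1 b hbU)).and
    ((eventually_ge_atTop T₀).and (eventually_ge_atTop 0))).exists
  refine ⟨flowIntegral φ T F, contMDiff_flowIntegral hφ hT0 F.contMDiff, fun x ↦ ?_, ?_,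
    fun s hs ↦ ?_⟩
  · rw [lieDeriv_flowIntegral hv hφ hT0 F.contMDiff]
    exact sub_nonneg.2 (hT₀ T hT x)
  · rw [lieDeriv_flowIntegral hv hφ hT0 F.contMDiff, hTF, (hF0 p (Or.inr rfl)).self_of_nhds]
    norm_num
  · obtain ⟨c, hc⟩ : ∃ c, ∀ᶠ y in 𝓝 s, F y = c := by
      rcases le_or_gt (r b) (r s) with hr | hr
      · exact ⟨1, hF1 s ⟨s, hs, by simp [h.fixed s hs], hr⟩⟩
      · exact ⟨0, hF0 s (Or.inl ⟨s, hs, by simp [h.fixed s hs], hr⟩)⟩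
    exact mfderiv_eq_zero_of_eventually_eq
      (eventually_flowIntegral_eq (fun t ↦ h.fixed s hs t) hc)

end Lyapunov

/-! ### A rank function on a graph without contours -/

section Contours

variable {V : Type*} {G : Digraph V}

theorem exists_path_of_transGen {x y : V} (h : Relation.TransGen G.Adj x y) :
    ∃ (k : ℕ) (α : ℕ → V), 0 < k ∧ (∀ i < k, G.Adj (α i) (α (i + 1))) ∧ α 0 = x ∧ α k = y := by
  induction h using Relation.TransGen.head_induction_on with
  | @single a h =>
    refine ⟨1, fun i ↦ Nat.casesOn i a fun _ ↦ y, one_pos, fun i hi ↦ ?_, rfl, rfl⟩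
    obtain rfl : i = 0 := by omega
    exact h
  | @head a c h' _ ih =>
    obtain ⟨k, α, -, hα, h0, hk⟩ := ih
    refine ⟨k + 1, fun i ↦ Nat.casesOn i a α, Nat.succ_pos k, fun i hi ↦ ?_, rfl, hk⟩
    cases i with
    | zero =>
      subst h0
      exact h'
    | succ i => exact hα i (by omega)

theorem not_transGen_self_of_not_hasContour (h : ¬ HasContour G) (x : V) :
    ¬ Relation.TransGen G.Adj x x := by
  intro hx
  obtain ⟨k, α, hk, hα, h0, hk'⟩ := exists_path_of_transGen hx
  refine h ⟨k, fun i ↦ α i, hk, fun i ↦ ?_, ?_⟩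
  · exact hα i i.2
  · simp [h0, hk']

/-- The number of points from which there is a path to the given one. -/
def graphRank (G : Digraph V) (x : V) : ℕ := {y | Relation.TransGen G.Adj y x}.ncard

/-- Every ancestor of `x` is one of `y`, and `x` is an ancestor of `y` but not of itself. -/
theorem graphRank_lt_graphRank [Finite V] (h : ¬ HasContour G) {x y : V} (hxy : G.Adj x y) :
    graphRank G x < graphRank G y := by
  refine Set.ncard_lt_ncard ⟨fun z hz ↦ hz.tail hxy, fun hsub ↦ ?_⟩ (toFinite _)
  exact not_transGen_self_of_not_hasContour h x (hsub (.single hxy))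

end Contours

/-! ### The flow of `v` is ranked -/

section RankedFlow

variable {n : ℕ} {M : Type*} [TopologicalSpace M] [T2Space M]
  [ChartedSpace (EuclideanSpace ℝ (Fin n)) M] [IsManifold (𝓡 n) ∞ M]
  {v : (x : M) → TangentSpace (𝓡 n) x} {φ : Flow ℝ M}

theorem map_eq_self_of_mem_singularPoints
    (hv : ContMDiff (𝓡 n) (𝓡 n).tangent ∞ (fun x ↦ (⟨x, v x⟩ : TangentBundle (𝓡 n) M)))
    (hφ : ∀ x, IsMIntegralCurve (φ · x) v) {x : M} (hx : x ∈ singularPoints v) (t : ℝ) :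
    φ t x = x := by
  have hv1 : ContMDiff (𝓡 n) (𝓡 n).tangent 1 (fun x ↦ (⟨x, v x⟩ : TangentBundle (𝓡 n) M)) :=
    hv.of_le (by simp)
  have : IsManifold (𝓡 n) 1 M := .of_le (n := ∞) (by simp)
  exact congrFun (isMIntegralCurve_Ioo_eq_of_contMDiff_boundaryless (t₀ := 0) hv1 (hφ x)
    (isMIntegralCurve_const hx) (by simp)) t

variable [CompactSpace M]

theorem exists_isRankedFlow
    (hv : ContMDiff (𝓡 n) (𝓡 n).tangent ∞ (fun x ↦ (⟨x, v x⟩ : TangentBundle (𝓡 n) M)))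
    (hφ : ∀ x, IsMIntegralCurve (φ · x) v) (hiso : HasIsolatedSingularPoints v)
    (hlim : ∀ γ : ℝ → M, IsMIntegralCurve γ v →
      alphaLimitSet γ ⊆ singularPoints v ∧ omegaLimitSet γ ⊆ singularPoints v)
    (hgraph : ¬ HasContour (graph v)) : ∃ r, IsRankedFlow φ (singularPoints v) r := by
  have hfix : ∀ s ∈ singularPoints v, ∀ t, φ t s = s := fun s hs t ↦
    map_eq_self_of_mem_singularPoints hv hφ hs t
  -- A fixed point is in the `ω`-limit set of its constant trajectory, hence singular. So singular
  -- points are the fixed points of the flow, a closed set, and a closed discrete set in a compact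
  -- space is finite.
  have hfix' : ∀ x, (∀ t, φ t x = x) → x ∈ singularPoints v := fun x hx ↦
    (hlim _ (hφ x)).2 (Tendsto.mapClusterPt (by simpa only [hx] using tendsto_const_nhds))
  have hclosed : IsClosed (singularPoints v) := by
    have : singularPoints v = ⋂ t, {x | φ t x = x} := by
      ext x
      simpa using ⟨hfix x, hfix' x⟩
    rw [this]
    exact isClosed_iInter fun t ↦ isClosed_eq (φ.continuous continuous_const continuous_id)
      continuous_id
  have hfin : (singularPoints v).Finite := by
    refine hclosed.isCompact.finite (isDiscrete_iff_nhdsNE.2 fun x hx ↦ ?_)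
    exact inf_principal_eq_bot.2 (hiso x hx)
  have := hfin.to_subtype
  have hcont : ∀ x, Continuous (φ · x) := fun x ↦
    φ.cont'.comp (continuous_id.prodMk continuous_const)
  classical
  refine ⟨fun x ↦ if hx : x ∈ singularPoints v then graphRank (graph v) ⟨x, hx⟩ else 0,
    hfin, hfix, fun x ↦ ?_, fun x ↦ ?_, fun x hx a ha b hb hxa hxb ↦ ?_⟩
  · exact exists_tendsto_atBot_of_clusterPt_subset_finite hfin (hcont x) fun y hy ↦
      (hlim _ (hφ x)).1 hy
  · exact exists_tendsto_atTop_of_clusterPt_subset_finite hfin (hcont x) fun y hy ↦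
      (hlim _ (hφ x)).2 hy
  · simp only [dif_pos ha, dif_pos hb]
    refine graphRank_lt_graphRank hgraph ⟨(φ · x), hφ x, ?_, hxa, hxb⟩
    by_contra! hc
    exact hx (hfix' x fun t ↦ (hc t 0).trans (φ.map_zero_apply x))

end RankedFlow

/-! ### Construction of the global potential -/

section GlobalPotential

variable {n : ℕ} {M : Type*} [TopologicalSpace M]
  [ChartedSpace (EuclideanSpace ℝ (Fin n)) M]
  {v : (x : M) → TangentSpace (𝓡 n) x} {φ : Flow ℝ M}

theorem mfderiv_add_const_smul_of_mfderiv_eq_zero {f g : M → ℝ} {x : M}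
    (hf : MDifferentiableAt (𝓡 n) 𝓘(ℝ, ℝ) f x) (hg : MDifferentiableAt (𝓡 n) 𝓘(ℝ, ℝ) g x)
    (hg0 : mfderiv (𝓡 n) 𝓘(ℝ, ℝ) g x = 0) (c : ℝ) :
    mfderiv (𝓡 n) 𝓘(ℝ, ℝ) (f + c • g) x = mfderiv (𝓡 n) 𝓘(ℝ, ℝ) f x := by
  let f' : TangentSpace (𝓡 n) x →L[ℝ] ℝ := mfderiv (𝓡 n) 𝓘(ℝ, ℝ) f x
  have hf' : HasMFDerivAt (𝓡 n) 𝓘(ℝ, ℝ) f x f' := hf.hasMFDerivAt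
  have hg' : HasMFDerivAt (𝓡 n) 𝓘(ℝ, ℝ) g x (0 : TangentSpace (𝓡 n) x →L[ℝ] ℝ) :=
    hg0 ▸ hg.hasMFDerivAt
  have h1 : f' + c • (0 : TangentSpace (𝓡 n) x →L[ℝ] ℝ) = f' := by rw [smul_zero, add_zero]
  exact (hf'.add (hg'.const_smul c)).mfderiv.trans h1

theorem lieDeriv_add_const_smul {f g : M → ℝ} {x : M} (hf : MDifferentiableAt (𝓡 n) 𝓘(ℝ, ℝ) f x)
    (hg : MDifferentiableAt (𝓡 n) 𝓘(ℝ, ℝ) g x) (c : ℝ) :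
    lieDeriv v (f + c • g) x = lieDeriv v f x + c * lieDeriv v g x :=
  DFunLike.congr_fun (hf.hasMFDerivAt.add (hg.hasMFDerivAt.const_smul c)).mfderiv (v x)

theorem contMDiff_add_const_smul {f g : M → ℝ} (hf : ContMDiff (𝓡 n) 𝓘(ℝ, ℝ) ∞ f)
    (hg : ContMDiff (𝓡 n) 𝓘(ℝ, ℝ) ∞ g) (c : ℝ) : ContMDiff (𝓡 n) 𝓘(ℝ, ℝ) ∞ (f + c • g) :=
  hf.add (contMDiff_const (c := c).mul hg)

variable [IsManifold (𝓡 n) ∞ M]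

/-- The restriction of a smooth metric to a smaller set. -/
def SmoothMetricOn.restrict {U W : Set M} (ρ : SmoothMetricOn (n := n) U) (h : W ⊆ U) :
    SmoothMetricOn (n := n) W :=
  ⟨ρ.inner, fun x hx ↦ ρ.symm x (h hx), fun x hx ↦ ρ.pos x (h hx), ρ.contMDiffOn.mono h⟩

theorem continuous_lieDeriv
    (hv : ContMDiff (𝓡 n) (𝓡 n).tangent ∞ (fun x ↦ (⟨x, v x⟩ : TangentBundle (𝓡 n) M)))
    {f : M → ℝ} (hf : ContMDiff (𝓡 n) 𝓘(ℝ, ℝ) ∞ f) : Continuous (lieDeriv v f) := by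
  refine continuous_iff_continuousAt.2 fun x₀ ↦ ?_
  have hl : ContDiffOn ℝ ∞ (fderiv ℝ (f ∘ (extChartAt (𝓡 n) x₀).symm))
      (extChartAt (𝓡 n) x₀).target :=
    (contDiffOn_comp_extChartAt_symm hf x₀).fderiv_of_isOpen (isOpen_extChartAt_target x₀)
      (by simp)
  have h1 := (hl.clm_apply (contDiffOn_chartField hv x₀)).continuousOn.continuousAt
    (extChartAt_target_mem_nhds (I := 𝓡 n) x₀)
  refine (h1.comp (f := extChartAt (𝓡 n) x₀)
    (continuousAt_extChartAt (I := 𝓡 n) x₀)).congr_of_eventuallyEq ?_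
  filter_upwards [extChartAt_source_mem_nhds (I := 𝓡 n) x₀] with x hx
  exact (fderiv_comp_extChartAt_symm_apply hf hx (v x)).symm.trans
    (congrArg (fderiv ℝ (f ∘ (extChartAt (𝓡 n) x₀).symm) (extChartAt (𝓡 n) x₀ x))
      (chartField_extChartAt hx)).symm

variable [T2Space M] [CompactSpace M]

/-- Strict increase at a point persists nearby and all the properties survive addition, so a finite
cover of `K` suffices. -/
theorem IsRankedFlow.exists_monotone_function_of_isCompact {S : Set M} {r : M → ℕ}
    (h : IsRankedFlow φ S r)
    (hv : ContMDiff (𝓡 n) (𝓡 n).tangent ∞ (fun x ↦ (⟨x, v x⟩ : TangentBundle (𝓡 n) M)))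
    (hφ : ∀ x, IsMIntegralCurve (φ · x) v)
    (hφs : ContMDiff (𝓘(ℝ, ℝ).prod (𝓡 n)) (𝓡 n) ∞ (fun p : ℝ × M ↦ φ p.1 p.2)) {K : Set M}
    (hK : IsCompact K) (hKS : Disjoint K S) :
    ∃ G : M → ℝ, ContMDiff (𝓡 n) 𝓘(ℝ, ℝ) ∞ G ∧ (∀ x, 0 ≤ lieDeriv v G x) ∧
      (∀ x ∈ K, 0 < lieDeriv v G x) ∧
      ∀ s ∈ S, ∀ᶠ y in 𝓝 s, mfderiv (𝓡 n) 𝓘(ℝ, ℝ) G y = 0 := by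
  refine hK.induction_on (p := fun A ↦ ∃ G : M → ℝ, ContMDiff (𝓡 n) 𝓘(ℝ, ℝ) ∞ G ∧
      (∀ x, 0 ≤ lieDeriv v G x) ∧ (∀ x ∈ A, 0 < lieDeriv v G x) ∧
      ∀ s ∈ S, ∀ᶠ y in 𝓝 s, mfderiv (𝓡 n) 𝓘(ℝ, ℝ) G y = 0) ?_ ?_ ?_ ?_
  · have h0 : ∀ x, mfderiv (𝓡 n) 𝓘(ℝ, ℝ) (fun _ : M ↦ (0 : ℝ)) x = 0 := fun x ↦ mfderiv_const
    exact ⟨fun _ ↦ 0, contMDiff_const, fun x ↦ Eq.le (DFunLike.congr_fun (h0 x) (v x)).symm,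
      fun x hx ↦ hx.elim, fun s _ ↦ .of_forall h0⟩
  · rintro A B hAB ⟨G, hG, hG0, hGB, hGS⟩
    exact ⟨G, hG, hG0, fun x hx ↦ hGB x (hAB hx), hGS⟩
  · rintro A B ⟨G, hG, hG0, hGA, hGS⟩ ⟨H, hH, hH0, hHB, hHS⟩
    have hadd : ∀ x, lieDeriv v (G + (1 : ℝ) • H) x = lieDeriv v G x + 1 * lieDeriv v H x :=
      fun x ↦ lieDeriv_add_const_smul (hG.mdifferentiable (by simp) x)
        (hH.mdifferentiable (by simp) x) 1
    refine ⟨G + (1 : ℝ) • H, contMDiff_add_const_smul hG hH 1, fun x ↦ ?_, fun x hx ↦ ?_,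
      fun s hs ↦ ?_⟩
    · linarith [hadd x, hG0 x, hH0 x]
    · rcases hx with hx | hx
      · linarith [hadd x, hGA x hx, hH0 x]
      · linarith [hadd x, hG0 x, hHB x hx]
    · filter_upwards [hGS s hs, hHS s hs] with y hGy hHy
      exact (mfderiv_add_const_smul_of_mfderiv_eq_zero (hG.mdifferentiable (by simp) y)
        (hH.mdifferentiable (by simp) y) hHy 1).trans hGy
  · intro x hx
    obtain ⟨G, hG, hG0, hGx, hGS⟩ := h.exists_monotone_function hφ hφs (disjoint_left.1 hKS hx)
    exact ⟨{y | 0 < lieDeriv v G y}, mem_nhdsWithin_of_mem_nhds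
      ((continuous_lieDeriv hv hG).continuousAt.eventually (lt_mem_nhds hGx)), G, hG, hG0,
      fun y hy ↦ hy, hGS⟩

/-- A function with given local behaviour at finitely many points. -/
theorem exists_contMDiff_eventuallyEq {S : Set M} (hS : S.Finite) {U : M → Set M}
    (hU : ∀ s ∈ S, U s ∈ 𝓝 s) {f : M → M → ℝ}
    (hf : ∀ s ∈ S, ContMDiffOn (𝓡 n) 𝓘(ℝ, ℝ) ∞ (f s) (U s)) :
    ∃ h : M → ℝ, ContMDiff (𝓡 n) 𝓘(ℝ, ℝ) ∞ h ∧ ∀ s ∈ S, h =ᶠ[𝓝 s] f s := by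
  obtain ⟨D, hD, hdisj⟩ := hS.t2_separation
  let W : M → Set M := fun s ↦ interior (U s) ∩ D s
  have hW : ∀ s, IsOpen (W s) := fun s ↦ isOpen_interior.inter (hD s).2
  have hsW : ∀ s ∈ S, s ∈ W s := fun s hs ↦ ⟨mem_interior_iff_mem_nhds.2 (hU s hs), (hD s).1⟩
  have hN : ∀ s, ∃ N : Set M, s ∈ S → N ∈ 𝓝 s ∧ IsClosed N ∧ N ⊆ W s := fun s ↦ by
    by_cases hs : s ∈ S
    · obtain ⟨N, hN, hNc, hNW⟩ := exists_mem_nhds_isClosed_subset ((hW s).mem_nhds (hsW s hs))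
      exact ⟨N, fun _ ↦ ⟨hN, hNc, hNW⟩⟩
    · exact ⟨∅, fun h ↦ absurd h hs⟩
  choose N hN using hN
  obtain ⟨h, hh⟩ := exists_contMDiffMap_forall_mem_convex_of_local (n := ⊤) (𝓡 n)
    -- The value is prescribed on the disjoint closed neighbourhoods `N s` and free elsewhere.
    -- Closedness lets the zero function serve as a local choice off the sets `W s`.
    (t := fun x : M ↦ {c : ℝ | ∀ s ∈ S, x ∈ N s → c = f s x}) (by
      intro x c hc d hd p q _ _ hpq s hs hx
      simp only [hc s hs hx, hd s hs hx, smul_eq_mul, ← add_mul, hpq, one_mul]) (by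
      intro x
      by_cases hx : ∃ s ∈ S, x ∈ W s
      · obtain ⟨s, hs, hx⟩ := hx
        refine ⟨W s, (hW s).mem_nhds hx, f s,
          (hf s hs).mono (inter_subset_left.trans interior_subset), fun y hy s' hs' hy' ↦ ?_⟩
        obtain rfl : s' = s := by
          by_contra hne
          exact disjoint_left.1 (hdisj hs' hs hne) ((hN s' hs').2.2 hy').2 hy.2
        rfl
      · refine ⟨(⋃ s ∈ S, N s)ᶜ, (hS.isClosed_biUnion fun s hs ↦
          (hN s hs).2.1).isOpen_compl.mem_nhds ?_, 0, contMDiffOn_const, fun y hy s hs hys ↦ ?_⟩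
        · simp only [mem_compl_iff, mem_iUnion, not_exists]
          exact fun s hs hxs ↦ hx ⟨s, hs, (hN s hs).2.2 hxs⟩
        · exact absurd (mem_biUnion hs hys) hy)
  exact ⟨h, h.contMDiff, fun s hs ↦ mem_of_superset (hN s hs).1 fun x hx ↦ hh x s hs hx⟩

theorem IsRankedFlow.exists_potential {r : M → ℕ}
    (h : IsRankedFlow φ (singularPoints v) r)
    (hv : ContMDiff (𝓡 n) (𝓡 n).tangent ∞ (fun x ↦ (⟨x, v x⟩ : TangentBundle (𝓡 n) M)))
    (hφ : ∀ x, IsMIntegralCurve (φ · x) v)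
    (hφs : ContMDiff (𝓘(ℝ, ℝ).prod (𝓡 n)) (𝓡 n) ∞ (fun p : ℝ × M ↦ φ p.1 p.2))
    (hgrad : ∀ x ∈ singularPoints v, IsLocallyGradientNear v x) :
    ∃ f : M → ℝ, ContMDiff (𝓡 n) 𝓘(ℝ, ℝ) ∞ f ∧
      ∀ x, 0 < lieDeriv v f x ∨ ∃ U : Set M, IsOpen U ∧ x ∈ U ∧
        ∃ ρ : SmoothMetricOn (n := n) U, ∀ y ∈ U, IsGradientAt f y (ρ.inner y) (v y) := by
  have hloc : ∀ s, ∃ (U : Set M) (g : M → ℝ), s ∈ singularPoints v → IsOpen U ∧ s ∈ U ∧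
      ContMDiffOn (𝓡 n) 𝓘(ℝ, ℝ) ∞ g U ∧
      ∃ ρ : SmoothMetricOn (n := n) U, ∀ y ∈ U, IsGradientAt g y (ρ.inner y) (v y) := fun s ↦ by
    by_cases hs : s ∈ singularPoints v
    · obtain ⟨U, hU, hsU, g, ρ, hg, hρ⟩ := hgrad s hs
      exact ⟨U, g, fun _ ↦ ⟨hU, hsU, hg, ρ, hρ⟩⟩
    · exact ⟨∅, 0, fun h ↦ absurd h hs⟩
  choose U g hUg using hloc
  obtain ⟨k, hk, hkg⟩ := exists_contMDiff_eventuallyEq h.finite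
    (fun s hs ↦ (hUg s hs).1.mem_nhds (hUg s hs).2.1) (fun s hs ↦ (hUg s hs).2.2.1)
  have hgradk : ∀ s ∈ singularPoints v, ∃ W ⊆ U s, IsOpen W ∧ s ∈ W ∧ ∀ y ∈ W,
      mfderiv (𝓡 n) 𝓘(ℝ, ℝ) k y = mfderiv (𝓡 n) 𝓘(ℝ, ℝ) (g s) y := fun s hs ↦ by
    have h1 : ∀ᶠ y in 𝓝 s, y ∈ U s ∧
        mfderiv (𝓡 n) 𝓘(ℝ, ℝ) k y = mfderiv (𝓡 n) 𝓘(ℝ, ℝ) (g s) y := by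
      filter_upwards [(hUg s hs).1.mem_nhds (hUg s hs).2.1, (hkg s hs).eventuallyEq_nhds]
        with y hy hy'
      exact ⟨hy, hy'.mfderiv_eq⟩
    obtain ⟨W, hW, hWo, hsW⟩ := eventually_nhds_iff.1 h1
    exact ⟨W, fun y hy ↦ (hW y hy).1, hWo, hsW, fun y hy ↦ (hW y hy).2⟩
  choose! W hWU hWo hsW hWk using hgradk
  -- Where `v` is the gradient of `k`, `dk(v) = ρ(v, v)`.
  have hpos : ∀ s ∈ singularPoints v, ∀ y ∈ W s, y ∉ singularPoints v → 0 < lieDeriv v k y := by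
    intro s hs y hy hyS
    obtain ⟨ρ, hρ⟩ := (hUg s hs).2.2.2
    have h1 := ρ.pos y (hWU s hs hy) (v y) hyS
    rw [hρ y (hWU s hs hy) (v y), ← hWk s hs y hy] at h1
    exact h1
  let K : Set M := (⋃ s ∈ singularPoints v, W s)ᶜ
  have hK : IsCompact K :=
    (isOpen_biUnion fun s hs ↦ hWo s hs).isClosed_compl.isCompact
  have hKS : Disjoint K (singularPoints v) :=
    disjoint_left.2 fun x hx hxS ↦ hx (mem_biUnion hxS (hsW x hxS))
  obtain ⟨G, hG, hG0, hGK, hGS⟩ := h.exists_monotone_function_of_isCompact hv hφ hφs hK hKS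
  obtain ⟨C, hC⟩ := hK.exists_bound_of_continuousOn (f := fun x ↦ lieDeriv v k x / lieDeriv v G x)
    ((continuous_lieDeriv hv hk).continuousOn.div (continuous_lieDeriv hv hG).continuousOn
      fun x hx ↦ (hGK x hx).ne')
  have hkd := hk.mdifferentiable (by simp)
  have hGd := hG.mdifferentiable (by simp)
  -- On `K` the derivative of `k` along `v` is at least `-|C|` times that of `G`, so the extra `1`
  -- makes the sum positive. Off `K`, `k` already increases at nonsingular points and `G` does no
  -- harm.
  refine ⟨k + (|C| + 1) • G, contMDiff_add_const_smul hk hG _, fun x ↦ ?_⟩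
  by_cases hxS : x ∈ singularPoints v
  · right
    obtain ⟨ρ, hρ⟩ := (hUg x hxS).2.2.2
    obtain ⟨V, hV, hVo, hxV⟩ := eventually_nhds_iff.1 (hGS x hxS)
    refine ⟨W x ∩ V, (hWo x hxS).inter hVo, ⟨hsW x hxS, hxV⟩,
      ρ.restrict (inter_subset_left.trans (hWU x hxS)), fun y hy a ↦ ?_⟩
    refine (hρ y (hWU x hxS hy.1) a).trans (Eq.symm ?_)
    rw [mfderiv_add_const_smul_of_mfderiv_eq_zero (hkd y) (hGd y) (hV y hy.2),
      hWk x hxS y hy.1]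
    rfl
  · left
    rw [lieDeriv_add_const_smul (hkd x) (hGd x)]
    by_cases hxK : x ∈ K
    · have h1 := hGK x hxK
      have h2 := (neg_le_of_abs_le (hC x hxK)).trans' (neg_le_neg (le_abs_self C))
      rw [le_div_iff₀ h1] at h2
      linarith
    · obtain ⟨s, hs, hxs⟩ : ∃ s ∈ singularPoints v, x ∈ W s := by simpa [K] using hxK
      have := hpos s hs x hxs hxS
      have := hG0 x
      positivity

end GlobalPotential

end VectorFieldGraph
end

theorem theorem5 {n : ℕ} {M : Type*} [TopologicalSpace M] [T2Space M] [CompactSpace M]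
    [ChartedSpace (EuclideanSpace ℝ (Fin n)) M] [IsManifold (𝓡 n) ∞ M]
    (v : (x : M) → TangentSpace (𝓡 n) x)
    (hv : ContMDiff (𝓡 n) (𝓡 n).tangent ∞ (fun x ↦ (⟨x, v x⟩ : TangentBundle (𝓡 n) M)))
    (hiso : VectorFieldGraph.HasIsolatedSingularPoints v)
    (hlim : ∀ γ : ℝ → M, IsMIntegralCurve γ v →
      VectorFieldGraph.alphaLimitSet γ ⊆ VectorFieldGraph.singularPoints v ∧
      VectorFieldGraph.omegaLimitSet γ ⊆ VectorFieldGraph.singularPoints v)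
    (hgrad : ∀ x ∈ VectorFieldGraph.singularPoints v, VectorFieldGraph.IsLocallyGradientNear v x)
    (hgraph : ¬ VectorFieldGraph.HasContour (VectorFieldGraph.graph v)) :
    ∃ (ρ : ContMDiffRiemannianMetric (𝓡 n) ∞ (EuclideanSpace ℝ (Fin n))
        (fun x : M ↦ TangentSpace (𝓡 n) x)) (f : M → ℝ),
      ContMDiff (𝓡 n) 𝓘(ℝ, ℝ) ∞ f ∧
      ∀ x, VectorFieldGraph.IsGradientAt f x (ρ.inner x) (v x) := by
  obtain ⟨φ, hφ, hφs⟩ := VectorFieldGraph.exists_smooth_flow hv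
  obtain ⟨r, hr⟩ := VectorFieldGraph.exists_isRankedFlow hv hφ hiso hlim hgraph
  obtain ⟨f, hf, hfv⟩ := hr.exists_potential hv hφ hφs hgrad
  obtain ⟨ρ, hρ⟩ := VectorFieldGraph.exists_riemannianMetric_isGradientAt hv hf hfv
  exact ⟨ρ, f, hf, hρ⟩
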